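/- For a number field $K$ with ring of integers $A$, let $\widehat A$ be the set of $\alpha\in A$ with $K=\mathbb{Q}(\alpha)$, and for $\alpha\in A$ let $F_\alpha$ be the characteristic polynomial of $\alpha$ over $\mathbb{Q}$. Put $I(\alpha)=[A:\mathbb{Z}[\alpha]]$ for $\alpha\in\widehat A$, $i(\alpha)=\gcd_{x\in\mathbb{Z}}F_\alpha(x)$ for $\alpha\in A$, and $$I(K)=\gcd_{\alpha\in\widehat A} I(\alpha),\qquad i(K)=\operatorname{lcm}_{\alpha\in\widehat A} i(\alpha).$$ Let $m>0$ be an integer with $m\neq 3$ such that $m^2+16$ is not divisible by the square of any odd integer greater than $1$, and let $K_m=\mathbb{Q}(\theta)$, where $\theta$ is a root of $x^4-mx^3-6x^2+mx+1$. Then $$I(K_m)=\begin{cases}2&\text{if } m \text{ is odd},\\ 1&\text{if } m\text{ is even,}\end{cases}\qquad i(K_m)=\begin{cases}1&\text{if } 1\le v_2(m)\le 3,\\ 4&\text{otherwise,}\end{cases}$$ where $v_2$ denotes the $2$-adic valuation. -/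

import Mathlib

open scoped NumberField IntermediateField

namespace CommonIndex

/-- An algebraic integer `α` of `K` is primitive if `K = ℚ(α)`. -/
def IsPrimitiveInt {K : Type*} [Field K] [NumberField K] (α : 𝓞 K) : Prop :=
  ℚ⟮(α : K)⟯ = ⊤

/-- The index `I(α) = [𝓞 K : ℤ[α]]` of an algebraic integer, as an index of additive groups
(it is finite exactly for primitive `α`; an infinite index has the value `0`). -/
noncomputable def elementIndex {K : Type*} [Field K] [NumberField K] (α : 𝓞 K) : ℕ :=
  (Subalgebra.toSubmodule (Algebra.adjoin ℤ {α})).toAddSubgroup.index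

/-- The index `I(K)`: the gcd of the indices of the primitive algebraic integers of `K`. -/
noncomputable def fieldIndex (K : Type*) [Field K] [NumberField K] : ℕ :=
  Nat.setGcd {n : ℕ | ∃ α : 𝓞 K, IsPrimitiveInt α ∧ n = elementIndex α}

/-- The characteristic polynomial `F_α` of an algebraic integer `α`, that is, of multiplication
by `α`; it is computed on the lattice `𝓞 K`, so that it has integer coefficients. -/
noncomputable def intCharpoly {K : Type*} [Field K] [NumberField K] (α : 𝓞 K) :
    Polynomial ℤ :=
  (Algebra.lmul ℤ (𝓞 K) α).charpoly

/-- `intCharpoly α` is the characteristic polynomial over `ℚ` of multiplication by `α` on `K`. -/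
theorem intCharpoly_map {K : Type*} [Field K] [NumberField K] (α : 𝓞 K) :
    (intCharpoly α).map (Int.castRingHom ℚ) = (Algebra.lmul ℚ K (α : K)).charpoly := by
  have h := Algebra.map_leftMulMatrix_localization ℤ (nonZeroDivisors ℤ) (Rₘ := ℚ) (Sₘ := K)
    (NumberField.RingOfIntegers.basis K) α
  have h1 : (Algebra.lmul ℤ (𝓞 K) α).charpoly
      = (Algebra.leftMulMatrix (NumberField.RingOfIntegers.basis K) α).charpoly :=
    (LinearMap.charpoly_toMatrix _ (NumberField.RingOfIntegers.basis K)).symm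
  have h2 : (Algebra.lmul ℚ K (α : K)).charpoly
      = (Algebra.leftMulMatrix ((NumberField.RingOfIntegers.basis K).localizationLocalization ℚ
        (nonZeroDivisors ℤ) K) (α : K)).charpoly :=
    (LinearMap.charpoly_toMatrix _ _).symm
  rw [intCharpoly, h1, h2, ← Matrix.charpoly_map]
  exact congrArg Matrix.charpoly h

/-- `i(α) = gcd {F_α(x) : x ∈ ℤ}`. -/
noncomputable def valueGcd {K : Type*} [Field K] [NumberField K] (α : 𝓞 K) : ℕ :=
  Nat.setGcd {n : ℕ | ∃ x : ℤ, n = ((intCharpoly α).eval x).natAbs}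

/-- The least common multiple of a set of natural numbers: the least positive common multiple,
or `0` if there is no positive common multiple. -/
noncomputable def setLcm (s : Set ℕ) : ℕ :=
  sInf {d : ℕ | 0 < d ∧ ∀ n ∈ s, n ∣ d}

/-- `i(K)`: the lcm of the numbers `i(α)` over the primitive algebraic integers `α` of `K`. -/
noncomputable def fieldValueLcm (K : Type*) [Field K] [NumberField K] : ℕ :=
  setLcm {n : ℕ | ∃ α : 𝓞 K, IsPrimitiveInt α ∧ n = valueGcd α}

/-- The polynomial `P_m = x⁴ - m x³ - 6 x² + m x + 1`. -/
noncomputable def simplestQuartic (m : ℤ) : Polynomial ℤ :=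
  Polynomial.X ^ 4 - Polynomial.C m * Polynomial.X ^ 3 - 6 * Polynomial.X ^ 2
    + Polynomial.C m * Polynomial.X + 1

end CommonIndex

/-! Put `u = θ - θ⁻¹`. Then `u² = mu + 4` and `θ² = uθ + 1`, so `K` is quadratic over `k = ℚ(√(m² +
16))`.

Only 2 can divide `I(K)`. The powers of `θ` have discriminant `4(m² + 16)³`, and an odd prime `p`
dividing `m² + 16` divides it exactly once; `4θ - m` is then a root of a quartic Eisenstein at `p`,
so `p` does not divide the index of `θ` (`not_dvd_det_powers_of_odd`).

For odd `m`, `x⁴ = x` holds in `𝓞 K / 2` (`two_dvd_pow_four_sub`). An element of odd index would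
have characteristic polynomial `X⁴ - X` mod 2, whose simple root 0 lifts to `ℤ_[2]`. That would
embed `K` in `ℚ_[2]`, while `P_m` has no root mod 8. So every index is even, and that of `θ` is not
divisible by 4. For even `m`, an explicit `β` has odd index (`IsLocalGenerator`).

The values of a monic quartic have gcd dividing 24. Hensel's lemma turns divisibility of all values
by 3 or by 8 into an embedding of `K` in `ℚ_[3]` or `ℚ_[2]`, and `P_m` has no root mod 3 or mod 8;
hence `i(α) ∣ 4`. If `m` is odd or `16 ∣ m`, then 2 splits in `k`, and some `α` has `F_α ≡ (X(X -
t))²` mod 4 with `t` odd, so that 4 is reached. Otherwise a single prime lies above 2, with residue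
field of 2 or 4 elements; `α` or `1 - α` is then invertible mod 2, and `F_α(0)` or `F_α(1)` is odd.
-/

namespace CommonIndex

open Polynomial

/-! ### Characteristic polynomials, `p`-adic embeddings and gcds of values. -/

section General

variable {K : Type*} [Field K] [NumberField K]

theorem intCharpoly_monic (α : 𝓞 K) : (intCharpoly α).Monic :=
  LinearMap.charpoly_monic _

theorem natDegree_intCharpoly (α : 𝓞 K) :
    (intCharpoly α).natDegree = Module.finrank ℚ K := by
  rw [intCharpoly, LinearMap.charpoly_natDegree, NumberField.RingOfIntegers.rank]

theorem aeval_intCharpoly (α : 𝓞 K) : aeval α (intCharpoly α) = 0 := by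
  have h := LinearMap.aeval_self_charpoly (Algebra.lmul ℤ (𝓞 K) α)
  rw [Polynomial.aeval_algHom_apply] at h
  have h2 := congrArg (fun f : Module.End ℤ (𝓞 K) => f 1) h
  simpa [intCharpoly] using h2

theorem eval_intCharpoly (α : 𝓞 K) (x : ℤ) :
    (intCharpoly α).eval x = Algebra.norm ℤ ((x : 𝓞 K) - α) := by
  rw [intCharpoly, Algebra.norm_apply, ← LinearMap.charpoly_toMatrix _
    (NumberField.RingOfIntegers.basis K), Matrix.eval_charpoly,
    ← LinearMap.det_toMatrix (NumberField.RingOfIntegers.basis K)]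
  congr 1
  have h : Algebra.lmul ℤ (𝓞 K) ((x : 𝓞 K) - α)
      = (x • (1 : Module.End ℤ (𝓞 K))) - Algebra.lmul ℤ (𝓞 K) α := by
    rw [map_sub]
    congr 1
    ext y
    simp
  change _ = LinearMap.toMatrix _ _ (Algebra.lmul ℤ (𝓞 K) ((x : 𝓞 K) - α))
  rw [h, map_sub, map_smul, LinearMap.toMatrix_one]
  congr 1
  ext i j
  rw [Matrix.scalar_apply, Matrix.diagonal_apply, Matrix.smul_apply, Matrix.one_apply]
  simp

theorem isIntegral_coe (α : 𝓞 K) : IsIntegral ℚ (α : K) := IsIntegral.of_finite ℚ _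

theorem map_intCharpoly_eq_minpoly {α : 𝓞 K} (hα : IsPrimitiveInt α) :
    (intCharpoly α).map (Int.castRingHom ℚ) = minpoly ℚ (α : K) := by
  have hdeg : (minpoly ℚ (α : K)).natDegree = Module.finrank ℚ K :=
    (Field.primitive_element_iff_minpoly_natDegree_eq ℚ (α : K)).1 hα
  have hm : ((intCharpoly α).map (Int.castRingHom ℚ)).Monic := (intCharpoly_monic α).map _
  refine (eq_of_monic_of_dvd_of_natDegree_le (minpoly.monic (isIntegral_coe α)) hm ?_ ?_)
  · apply minpoly.dvd
    have h := congrArg (algebraMap (𝓞 K) K) (aeval_intCharpoly α)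
    rw [← Polynomial.aeval_algebraMap_apply, map_zero] at h
    have h3 : Int.castRingHom ℚ = algebraMap ℤ ℚ := rfl
    rw [h3, Polynomial.aeval_map_algebraMap]
    exact h
  · rw [hdeg, (intCharpoly_monic α).natDegree_map, natDegree_intCharpoly]

theorem intCharpoly_eq_of_aeval_eq_zero {α : 𝓞 K} (hα : IsPrimitiveInt α) {G : ℤ[X]}
    (hG : G.Monic) (hdeg : G.natDegree = Module.finrank ℚ K) (h0 : aeval α G = 0) :
    intCharpoly α = G := by
  apply Polynomial.map_injective (Int.castRingHom ℚ) Int.cast_injective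
  rw [map_intCharpoly_eq_minpoly hα]
  refine (eq_of_monic_of_dvd_of_natDegree_le (minpoly.monic (isIntegral_coe α)) (hG.map _)
    ?_ ?_).symm
  · apply minpoly.dvd
    have h := congrArg (algebraMap (𝓞 K) K) h0
    rw [← Polynomial.aeval_algebraMap_apply, map_zero] at h
    have h3 : Int.castRingHom ℚ = algebraMap ℤ ℚ := rfl
    rw [h3, Polynomial.aeval_map_algebraMap]
    exact h
  · rw [(Field.primitive_element_iff_minpoly_natDegree_eq ℚ (α : K)).1 hα, hG.natDegree_map, hdeg]

/-- A `p`-adic root of the characteristic polynomial of a primitive element gives an embedding of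
`K` into `ℚ_[p]`, so every monic integer polynomial with a root in `K` has a root in `ℤ_[p]`. -/
theorem exists_padicInt_root {p : ℕ} [Fact p.Prime] {α : 𝓞 K} (hα : IsPrimitiveInt α)
    {z : ℤ_[p]} (hz : aeval z (intCharpoly α) = 0) {G : ℤ[X]} (hG : G.Monic) {θ : K}
    (hθ : aeval θ G = 0) : ∃ y : ℤ_[p], aeval y G = 0 := by
  have hz' : aeval (z : ℚ_[p]) (minpoly ℚ (α : K)) = 0 := by
    rw [← map_intCharpoly_eq_minpoly hα]
    have h3 : Int.castRingHom ℚ = algebraMap ℤ ℚ := rfl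
    rw [h3, Polynomial.aeval_map_algebraMap]
    have h := congrArg (PadicInt.Coe.ringHom (p := p)) hz
    have h4 := Polynomial.hom_eval₂ (intCharpoly α) (algebraMap ℤ ℤ_[p])
      (PadicInt.Coe.ringHom (p := p)) z
    rw [Polynomial.aeval_def] at h ⊢
    rw [h4, map_zero] at h
    have h5 : algebraMap ℤ ℚ_[p] = PadicInt.Coe.ringHom.comp (algebraMap ℤ ℤ_[p]) :=
      RingHom.ext_int _ _
    rw [h5]
    exact h
  let f : ℚ⟮(α : K)⟯ →ₐ[ℚ] ℚ_[p] :=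
    (IntermediateField.adjoin.powerBasis (isIntegral_coe α)).lift (z : ℚ_[p]) (by
      rw [IntermediateField.adjoin.powerBasis_gen, IntermediateField.minpoly_gen]
      exact hz')
  have hα' : ℚ⟮(α : K)⟯ = ⊤ := hα
  let y : ℚ_[p] := f ⟨θ, hα' ▸ IntermediateField.mem_top⟩
  have hy : aeval y G = 0 := by
    let θ' : ℚ⟮(α : K)⟯ := ⟨θ, hα' ▸ IntermediateField.mem_top⟩
    have h1 : aeval θ' G = 0 := by
      apply (algebraMap ℚ⟮(α : K)⟯ K).injective
      rw [← Polynomial.aeval_algebraMap_apply, map_zero]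
      exact hθ
    have h2 := Polynomial.hom_eval₂ G (algebraMap ℤ ℚ⟮(α : K)⟯) (f : ℚ⟮(α : K)⟯ →+* ℚ_[p]) θ'
    rw [Polynomial.aeval_def] at h1 ⊢
    rw [h1, map_zero] at h2
    rw [h2]
    congr 1
    exact RingHom.ext_int _ _
  have hint : IsIntegral ℤ_[p] y := by
    refine ⟨G.map (algebraMap ℤ ℤ_[p]), hG.map _, ?_⟩
    rw [Polynomial.aeval_def] at hy
    rw [Polynomial.eval₂_map, ← hy]
    congr 1
  obtain ⟨w, hw⟩ := IsIntegrallyClosed.isIntegral_iff.1 hint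
  refine ⟨w, ?_⟩
  apply (IsFractionRing.injective ℤ_[p] ℚ_[p])
  rw [← Polynomial.aeval_algebraMap_apply, hw, hy, map_zero]

theorem norm_add_mul_modEq (x y : 𝓞 K) (n : ℕ) :
    (Algebra.norm ℤ (x + n * y) : ZMod n) = (Algebra.norm ℤ x : ZMod n) := by
  have key : ∀ w : 𝓞 K, (Algebra.norm ℤ w : ZMod n)
      = ((Algebra.leftMulMatrix (NumberField.RingOfIntegers.basis K) w).map
          (Int.castRingHom (ZMod n))).det := by
    intro w
    rw [Algebra.norm_eq_matrix_det (NumberField.RingOfIntegers.basis K),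
      ← eq_intCast (Int.castRingHom (ZMod n)), RingHom.map_det]
    rfl
  rw [key, key]
  congr 1
  ext i j
  have : (n : 𝓞 K) * y = (n : ℤ) • y := by simp
  rw [this, map_add, map_smul, Matrix.map_apply, Matrix.add_apply, Matrix.smul_apply]
  simp

theorem valueGcd_dvd (α : 𝓞 K) (x : ℤ) : (valueGcd α : ℤ) ∣ (intCharpoly α).eval x := by
  rw [← Int.dvd_natAbs, Int.natCast_dvd_natCast]
  exact Nat.setGcd_dvd_of_mem ⟨x, rfl⟩

theorem dvd_valueGcd {α : 𝓞 K} {n : ℕ} (h : ∀ x : ℤ, (n : ℤ) ∣ (intCharpoly α).eval x) :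
    n ∣ valueGcd α := by
  rw [valueGcd, Nat.dvd_setGcd_iff]
  rintro _ ⟨x, rfl⟩
  rw [← Int.natCast_dvd_natCast, Int.dvd_natAbs]
  exact h x

theorem setLcm_eq {s : Set ℕ} {n : ℕ} (hn : 0 < n) (h : ∀ k ∈ s, k ∣ n)
    (h' : ∀ d, (∀ k ∈ s, k ∣ d) → n ∣ d) : setLcm s = n := by
  apply le_antisymm
  · exact Nat.sInf_le ⟨hn, h⟩
  · have hmem := Nat.sInf_mem (s := {d : ℕ | 0 < d ∧ ∀ k ∈ s, k ∣ d}) ⟨n, hn, h⟩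
    exact Nat.le_of_dvd hmem.1 (h' _ hmem.2)

end General

/-! ### Hensel's lemma for monic integer quartics. -/

section Quartic

theorem exists_quartic_coeffs {F : ℤ[X]} (hF : F.Monic) (hdeg : F.natDegree = 4) :
    ∃ a b c d : ℤ, F = X ^ 4 + C a * X ^ 3 + C b * X ^ 2 + C c * X + C d := by
  refine ⟨F.coeff 3, F.coeff 2, F.coeff 1, F.coeff 0, ?_⟩
  have h4 : F.coeff 4 = 1 := by rw [← hdeg]; exact hF
  conv_lhs => rw [F.as_sum_range, hdeg]
  simp [Finset.sum_range_succ, h4, ← C_mul_X_pow_eq_monomial]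
  ring

/-- The values of a monic integer quartic have gcd dividing `4! = 24`. -/
theorem dvd_factorial_of_dvd_eval {F : ℤ[X]} (hF : F.Monic) (hdeg : F.natDegree = 4) {n : ℤ}
    (h : ∀ x : ℤ, n ∣ F.eval x) : n ∣ 24 := by
  obtain ⟨a, b, c, d, rfl⟩ := exists_quartic_coeffs hF hdeg
  have h0 := h 0
  have h1 := h 1
  have h2 := h 2
  have h3 := h 3
  have h4 := h 4
  simp at h0 h1 h2 h3 h4
  -- The fourth finite difference of a monic quartic is `4!`.
  have := ((h4.sub (h3.mul_left 4)).add (h2.mul_left 6)).sub (h1.mul_left 4) |>.add h0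
  ring_nf at this
  exact this

variable {p : ℕ} [Fact p.Prime]

theorem exists_padicInt_root_of_not_dvd_derivative {F : ℤ[X]} {a : ℤ} (h : (p : ℤ) ∣ F.eval a)
    (h' : ¬ (p : ℤ) ∣ F.derivative.eval a) : ∃ z : ℤ_[p], aeval z F = 0 := by
  have e1 : ∀ G : ℤ[X], aeval (a : ℤ_[p]) G = ((G.eval a : ℤ) : ℤ_[p]) := by
    intro G
    have := Polynomial.aeval_algebraMap_apply ℤ_[p] a G
    simpa using this
  have hd : ‖aeval (a : ℤ_[p]) F.derivative‖ = 1 := by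
    rw [e1]
    refine le_antisymm (PadicInt.norm_le_one _) (not_lt.1 fun hlt => h' ?_)
    exact (PadicInt.norm_int_lt_one_iff_dvd _).1 hlt
  obtain ⟨z, hz, -⟩ := hensels_lemma (F := F) (a := (a : ℤ_[p])) (by
    rw [hd, one_pow, e1]
    exact (PadicInt.norm_int_lt_one_iff_dvd _).2 h)
  exact ⟨z, hz⟩

/-- Hensel's lemma at a point where the derivative is exactly divisible by `2`. -/
theorem exists_padicInt_two_root {F : ℤ[X]} {a : ℤ} (h : 8 ∣ F.eval a)
    (h' : ¬ 4 ∣ F.derivative.eval a) : ∃ z : ℤ_[2], aeval z F = 0 := by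
  have e1 : ∀ G : ℤ[X], aeval (a : ℤ_[2]) G = ((G.eval a : ℤ) : ℤ_[2]) := by
    intro G
    have := Polynomial.aeval_algebraMap_apply ℤ_[2] a G
    simpa using this
  have hF : ‖aeval (a : ℤ_[2]) F‖ ≤ (2 : ℝ) ^ (-3 : ℤ) := by
    rw [e1]
    exact (PadicInt.norm_int_le_pow_iff_dvd (p := 2) (n := 3)).2 (by simpa using h)
  have hd : (2 : ℝ) ^ (-2 : ℤ) < ‖aeval (a : ℤ_[2]) F.derivative‖ := by
    rw [e1]
    by_contra hcon
    exact h' (by simpa using (PadicInt.norm_int_le_pow_iff_dvd (p := 2) (n := 2)).1 (not_lt.1 hcon))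
  have hd2 : (2 : ℝ) ^ (-1 : ℤ) ≤ ‖aeval (a : ℤ_[2]) F.derivative‖ := by
    by_contra hcon
    have := (PadicInt.norm_lt_pow_iff_norm_le_pow_sub_one (p := 2)
      (aeval (a : ℤ_[2]) F.derivative) (-1)).1 (by simpa using hcon)
    norm_num at this hd
    linarith
  obtain ⟨z, hz, -⟩ := hensels_lemma (F := F) (a := (a : ℤ_[2])) (by
    norm_num at hF hd2
    nlinarith)
  exact ⟨z, hz⟩

/-- The values at 0, 1, 2, 3 force the linear coefficient `F'(0)` to be 2 mod 4, so Hensel's lemma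
applies at 0. -/
theorem exists_padicInt_root_of_eight_dvd {F : ℤ[X]} (hF : F.Monic) (hdeg : F.natDegree = 4)
    (h : ∀ x : ℤ, 8 ∣ F.eval x) : ∃ z : ℤ_[2], aeval z F = 0 := by
  apply exists_padicInt_two_root (h 0)
  obtain ⟨a, b, c, d, rfl⟩ := exists_quartic_coeffs hF hdeg
  have h0 := h 0
  have h1 := h 1
  have h2 := h 2
  have h3 := h 3
  simp at h0 h1 h2 h3 ⊢
  omega

/-- Mod 3, `F = (X³ - X)(X + a)`, so `F'(0) = -a` and `F'(1) = 2(1 + a)` cannot both vanish. -/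
theorem exists_padicInt_root_of_three_dvd {F : ℤ[X]} (hF : F.Monic) (hdeg : F.natDegree = 4)
    (h : ∀ x : ℤ, 3 ∣ F.eval x) : ∃ z : ℤ_[3], aeval z F = 0 := by
  by_cases h0' : (3 : ℤ) ∣ F.derivative.eval 0
  · refine exists_padicInt_root_of_not_dvd_derivative (p := 3) (a := 1) (h 1) ?_
    obtain ⟨a, b, c, d, rfl⟩ := exists_quartic_coeffs hF hdeg
    have h0 := h 0
    have h1 := h 1
    have h2 := h 2
    simp at h0 h1 h2 h0' ⊢
    omega
  · exact exists_padicInt_root_of_not_dvd_derivative (p := 3) (a := 0) (h 0) h0'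

end Quartic

/-! ### The polynomial `P_m`: no roots mod 8 or mod 3, irreducibility. -/

section SimplestQuartic

theorem simplestQuartic_eq (m : ℤ) : simplestQuartic m
    = X ^ 4 + C (-m) * X ^ 3 + C (-6) * X ^ 2 + C m * X + C 1 := by
  simp [simplestQuartic]
  ring

theorem natDegree_simplestQuartic (m : ℤ) : (simplestQuartic m).natDegree = 4 := by
  rw [simplestQuartic_eq]
  compute_degree!

theorem simplestQuartic_monic (m : ℤ) : (simplestQuartic m).Monic := by
  rw [simplestQuartic_eq]
  monicity!

theorem aeval_simplestQuartic {A : Type*} [CommRing A] (m : ℤ) (x : A) :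
    aeval x (simplestQuartic m) = x ^ 4 - m * x ^ 3 - 6 * x ^ 2 + m * x + 1 := by
  simp [simplestQuartic, map_ofNat]

theorem aeval_simplestQuartic_two_ne_zero (m : ℤ) (z : ℤ_[2]) :
    aeval z (simplestQuartic m) ≠ 0 := by
  intro h
  rw [aeval_simplestQuartic] at h
  have h8 := congrArg (PadicInt.toZModPow (p := 2) 3) h
  simp only [map_add, map_sub, map_mul, map_pow, map_intCast, map_ofNat, map_one, map_zero] at h8
  generalize PadicInt.toZModPow (p := 2) 3 z = x at h8
  generalize ((m : ℤ) : ZMod (2 ^ 3)) = n at h8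
  revert x n
  decide

theorem aeval_simplestQuartic_three_ne_zero (m : ℤ) (z : ℤ_[3]) :
    aeval z (simplestQuartic m) ≠ 0 := by
  intro h
  rw [aeval_simplestQuartic] at h
  have h3 := congrArg (PadicInt.toZMod (p := 3)) h
  simp only [map_add, map_sub, map_mul, map_pow, map_intCast, map_ofNat, map_one, map_zero] at h3
  generalize PadicInt.toZMod (p := 3) z = x at h3
  generalize ((m : ℤ) : ZMod 3) = n at h3
  revert x n
  decide

theorem simplestQuartic_irreducible {m : ℤ} (hm : 0 < m) (hm3 : m ≠ 3) :
    Irreducible (simplestQuartic m) := by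
  have hroot : ∀ x : ℤ, (simplestQuartic m).eval x ≠ 0 := by
    intro x hx
    apply aeval_simplestQuartic_three_ne_zero m (x : ℤ_[3])
    have := Polynomial.aeval_algebraMap_apply ℤ_[3] x (simplestQuartic m)
    simpa [hx] using this
  rw [(simplestQuartic_monic m).irreducible_iff_natDegree']
  refine ⟨fun h => by simpa [h] using natDegree_simplestQuartic m, ?_⟩
  intro f g hf hg hfg hmem
  rw [natDegree_simplestQuartic, Finset.mem_Ioc] at hmem
  have hd : f.natDegree + g.natDegree = 4 := by
    rw [← natDegree_simplestQuartic m, ← hfg, hf.natDegree_mul hg]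
  have hcases : g.natDegree = 1 ∨ g.natDegree = 2 := by omega
  rcases hcases with h1 | h2
  · have hg1 : g = X + C (g.coeff 0) := by
      have h4 : g.coeff 1 = 1 := by rw [← h1]; exact hg
      conv_lhs => rw [g.as_sum_range, h1]
      simp [Finset.sum_range_succ, h4, ← C_mul_X_pow_eq_monomial]
      ring
    apply hroot (-g.coeff 0)
    rw [← hfg, eval_mul, hg1]
    simp
  · have hf2 : f.natDegree = 2 := by omega
    have quad : ∀ q : ℤ[X], q.Monic → q.natDegree = 2 →
        q = X ^ 2 + C (q.coeff 1) * X + C (q.coeff 0) := by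
      intro q hq hq2
      have h4 : q.coeff 2 = 1 := by rw [← hq2]; exact hq
      conv_lhs => rw [q.as_sum_range, hq2]
      simp [Finset.sum_range_succ, h4, ← C_mul_X_pow_eq_monomial]
      ring
    rw [quad f hf hf2, quad g hg h2] at hfg
    generalize f.coeff 1 = a at hfg
    generalize f.coeff 0 = b at hfg
    generalize g.coeff 1 = c at hfg
    generalize g.coeff 0 = d at hfg
    have key : X ^ 4 + C (a + c) * X ^ 3 + C (a * c + b + d) * X ^ 2 + C (a * d + b * c) * X
        + C (b * d) = (X ^ 4 + C (-m) * X ^ 3 + C (-6) * X ^ 2 + C m * X + C 1 : ℤ[X]) := by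
      rw [← simplestQuartic_eq, ← hfg]
      simp only [map_add, map_mul]
      ring
    have k0 := congrArg (eval 0) key
    have k1 := congrArg (eval 1) key
    have k2 := congrArg (eval (-1)) key
    have k3 := congrArg (eval 2) key
    simp only [eval_add, eval_mul, eval_pow, eval_X, eval_C] at k0 k1 k2 k3
    replace k0 : b * d = 1 := by linarith
    -- Constant terms 1, 1 force `m = 0`. With -1, -1 one gets `ac = -4` and `a + c = -m`, which
    -- leaves only `m = 0` and `m = ±3`.
    rcases Int.mul_eq_one_iff_eq_one_or_neg_one.1 k0 with ⟨rfl, rfl⟩ | ⟨rfl, rfl⟩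
    · omega
    · have hac : a * c = -4 := by linarith
      have hdvd : a ∣ 4 := ⟨-c, by linarith⟩
      have hle : a ≤ 4 := Int.le_of_dvd (by norm_num) hdvd
      have hge : -4 ≤ a := by
        have := Int.le_of_dvd (by norm_num) ((neg_dvd).2 hdvd)
        linarith
      interval_cases a <;> omega

end SimplestQuartic

/-! ### Determinants of families with respect to an integral basis. -/

section Basis

variable {R : Type*} [CommRing R] (b : Module.Basis (Fin 4) ℤ R)

theorem discr_eq_det_sq_mul (v : Fin 4 → R) :
    Algebra.discr ℤ v = b.det v ^ 2 * Algebra.discr ℤ b := by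
  rw [Module.Basis.det_apply, ← Algebra.discr_of_matrix_vecMul b (b.toMatrix v)]
  congr 1
  ext i
  rw [← b.sum_toMatrix_smul_self v i]
  simp [Matrix.vecMul, dotProduct, mul_comm]

theorem repr_sum_smul (v : Fin 4 → R) (c : Fin 4 → ℤ) :
    ⇑(b.repr (∑ i, c i • v i)) = (b.toMatrix v).mulVec c := by
  ext j
  simp only [map_sum, map_smul, Finsupp.coe_finsetSum, Finset.sum_apply, Finsupp.smul_apply,
    smul_eq_mul, Matrix.mulVec, dotProduct, Module.Basis.toMatrix_apply]
  exact Finset.sum_congr rfl fun i _ => mul_comm _ _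

theorem intCast_dvd_iff_repr (n : ℤ) (z : R) : (n : R) ∣ z ↔ ∀ i, n ∣ b.repr z i := by
  constructor
  · rintro ⟨w, rfl⟩ i
    rw [← zsmul_eq_mul, map_smul]
    exact ⟨b.repr w i, by simp⟩
  · intro h
    choose c hc using h
    refine ⟨∑ i, c i • b i, ?_⟩
    conv_lhs => rw [← b.sum_repr z]
    rw [Finset.mul_sum]
    refine Finset.sum_congr rfl fun i _ => ?_
    rw [hc i, mul_smul, zsmul_eq_mul, zsmul_eq_mul]

theorem det_smul_mem_span (v : Fin 4 → R) (z : R) :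
    ∃ c : Fin 4 → ℤ, b.det v • z = ∑ i, c i • v i := by
  refine ⟨(b.toMatrix v).cramer (b.repr z), b.repr.injective ?_⟩
  ext j
  rw [repr_sum_smul, Matrix.mulVec_cramer, map_smul, Module.Basis.det_apply]
  simp

theorem dvd_coeff_of_dvd_sum {p : ℤ} (hp : Prime p) {v : Fin 4 → R} (hv : ¬ p ∣ b.det v)
    {c : Fin 4 → ℤ} (h : (p : R) ∣ ∑ i, c i • v i) (i : Fin 4) : p ∣ c i := by
  rw [intCast_dvd_iff_repr b, repr_sum_smul] at h
  choose w hw using h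
  have h1 := congrArg ((b.toMatrix v).adjugate.mulVec) (funext hw : _ = fun i => p * w i)
  rw [Matrix.mulVec_mulVec, Matrix.adjugate_mul, Matrix.smul_mulVec, Matrix.one_mulVec] at h1
  have h2 := congrFun h1 i
  have h3 : (fun i => p * w i) = p • w := rfl
  rw [h3, Matrix.mulVec_smul] at h2
  simp only [Pi.smul_apply, smul_eq_mul] at h2
  exact (hp.dvd_or_dvd ⟨_, h2⟩).resolve_left hv

/-- If `p` divided the determinant, a kernel vector of the matrix mod `p` would lift to integer
coefficients, not all divisible by `p`, of a combination divisible by `p`. -/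
theorem not_dvd_det_of_saturated {p : ℕ} [Fact p.Prime] {v : Fin 4 → R}
    (h : ∀ c : Fin 4 → ℤ, (p : R) ∣ ∑ i, c i • v i → ∀ i, (p : ℤ) ∣ c i) :
    ¬ (p : ℤ) ∣ b.det v := by
  intro hdvd
  have h0 : ((b.toMatrix v).map (Int.castRingHom (ZMod p))).det = 0 := by
    have := RingHom.map_det (Int.castRingHom (ZMod p)) (b.toMatrix v)
    rw [RingHom.mapMatrix_apply] at this
    rw [← this, ← Module.Basis.det_apply]
    simpa using (ZMod.intCast_zmod_eq_zero_iff_dvd _ _).2 hdvd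
  obtain ⟨w, hw, hw0⟩ := Matrix.exists_mulVec_eq_zero_iff.2 h0
  choose c hc using fun i => ZMod.intCast_surjective (w i)
  apply hw
  ext i
  rw [← hc i, Pi.zero_apply, ZMod.intCast_zmod_eq_zero_iff_dvd]
  refine h c ?_ i
  have := (intCast_dvd_iff_repr b (p : ℤ) (∑ i, c i • v i)).2 (fun j => ?_)
  · simpa using this
  rw [repr_sum_smul, ← ZMod.intCast_zmod_eq_zero_iff_dvd]
  have h1 := congrFun hw0 j
  simp only [Matrix.mulVec, dotProduct, Matrix.map_apply, ← hc, Pi.zero_apply] at h1 ⊢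
  push_cast
  simpa using h1

theorem linearIndependent_of_det_ne_zero {v : Fin 4 → R} (h : b.det v ≠ 0) :
    LinearIndependent ℤ v := by
  rw [Fintype.linearIndependent_iff]
  intro c hc
  have h1 := repr_sum_smul b v c
  rw [hc, map_zero] at h1
  have h2 : c = 0 := Matrix.eq_zero_of_mulVec_eq_zero (M := b.toMatrix v)
    (by rwa [← Module.Basis.det_apply]) (by rw [← h1]; rfl)
  intro i
  rw [h2, Pi.zero_apply]

theorem det_ne_zero_of_linearIndependent {v : Fin 4 → R} (h : LinearIndependent ℤ v) :
    b.det v ≠ 0 := by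
  intro h0
  rw [Module.Basis.det_apply] at h0
  obtain ⟨c, hc, hc0⟩ := Matrix.exists_mulVec_eq_zero_iff.2 h0
  apply hc
  ext i
  refine Fintype.linearIndependent_iff.1 h c (b.repr.injective ?_) i
  ext j
  rw [repr_sum_smul, hc0, map_zero]
  rfl

end Basis

/-! ### The index of `ℤ[α]` as the determinant of `1, α, α², α³`. -/

section Lattice

variable {K : Type*} [Field K] [NumberField K]

/-- The family `1, α, α², α³`. -/
def powers (α : 𝓞 K) : Fin 4 → 𝓞 K := fun i => α ^ (i : ℕ)

theorem finrank_eq_four_of_basis (b : Module.Basis (Fin 4) ℤ (𝓞 K)) :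
    Module.finrank ℚ K = 4 := by
  rw [← NumberField.RingOfIntegers.rank, Module.finrank_eq_card_basis b, Fintype.card_fin]

variable (b : Module.Basis (Fin 4) ℤ (𝓞 K))

include b in
theorem adjoin_eq_span_powers (α : 𝓞 K) :
    Subalgebra.toSubmodule (Algebra.adjoin ℤ {α}) = Submodule.span ℤ (Set.range (powers α)) := by
  classical
  have hdeg : (intCharpoly α).natDegree = 4 := by
    rw [natDegree_intCharpoly, finrank_eq_four_of_basis b]
  apply le_antisymm
  · intro x hx
    obtain ⟨f, rfl⟩ := (Algebra.adjoin_singleton_eq_range_aeval ℤ α ▸ hx :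
      x ∈ (aeval α : ℤ[X] →ₐ[ℤ] 𝓞 K).range)
    have h1 : aeval α f = aeval α (f %ₘ intCharpoly α) := by
      conv_lhs => rw [← modByMonic_add_div f (intCharpoly α)]
      rw [map_add, map_mul, aeval_intCharpoly, zero_mul, add_zero]
    have hlt : (f %ₘ intCharpoly α).natDegree < 4 := by
      rw [← hdeg]
      exact natDegree_modByMonic_lt _ (intCharpoly_monic α)
        (fun h => by rw [h, natDegree_one] at hdeg; omega)
    change aeval α f ∈ _
    rw [h1, aeval_eq_sum_range' hlt, Finset.sum_range]
    exact Submodule.sum_mem _ fun i _ =>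
      Submodule.smul_mem _ _ (Submodule.subset_span ⟨i, rfl⟩)
  · rw [Submodule.span_le]
    rintro _ ⟨i, rfl⟩
    exact Subalgebra.pow_mem _ (Algebra.self_mem_adjoin_singleton ℤ α) _

theorem elementIndex_eq_natAbs_det {α : 𝓞 K} (h : b.det (powers α) ≠ 0) :
    elementIndex α = (b.det (powers α)).natAbs := by
  let B := Module.Basis.span (linearIndependent_of_det_ne_zero b h)
  rw [elementIndex, adjoin_eq_span_powers b]
  have := AddSubgroup.index_eq_natAbs_det b
    (Submodule.span ℤ (Set.range (powers α))).toAddSubgroup B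
  rw [this]
  congr 2
  ext i
  exact congrArg (fun x => ((x : 𝓞 K) : K))
    (congrArg Subtype.val (Module.Basis.span_apply (linearIndependent_of_det_ne_zero b h) i))

include b in
theorem isPrimitiveInt_of_linearIndependent {α : 𝓞 K} (h : LinearIndependent ℤ (powers α)) :
    IsPrimitiveInt α := by
  rw [IsPrimitiveInt, Field.primitive_element_iff_minpoly_natDegree_eq]
  apply le_antisymm (minpoly.natDegree_le _)
  rw [finrank_eq_four_of_basis b]
  by_contra hlt
  have hdeg : (minpoly ℤ α).natDegree < 4 := by
    have h2 := minpoly.isIntegrallyClosed_eq_field_fractions ℚ K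
      (NumberField.RingOfIntegers.isIntegral α)
    have h3 := (minpoly.monic (NumberField.RingOfIntegers.isIntegral α)).natDegree_map
      (algebraMap ℤ ℚ)
    rw [← h2] at h3
    rw [← h3]
    exact not_le.1 hlt
  have h0 := minpoly.aeval ℤ α
  rw [aeval_eq_sum_range' hdeg, Finset.sum_range] at h0
  have h1 := Fintype.linearIndependent_iff.1 h _ h0
  apply (minpoly.monic (NumberField.RingOfIntegers.isIntegral α)).ne_zero
  ext n
  by_cases hn : n < 4
  · simpa using h1 ⟨n, hn⟩
  · rw [coeff_eq_zero_of_natDegree_lt (by omega), coeff_zero]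

theorem linearIndependent_powers_of_isPrimitiveInt {α : 𝓞 K} (hr : Module.finrank ℚ K = 4)
    (h : IsPrimitiveInt α) : LinearIndependent ℤ (powers α) := by
  rw [Fintype.linearIndependent_iff]
  intro c hc
  have hdeg := (Field.primitive_element_iff_minpoly_natDegree_eq ℚ (α : K)).1 h
  have h1 := linearIndependent_pow (K := ℚ) (α : K)
  rw [Fintype.linearIndependent_iff] at h1
  let e : Fin 4 ≃ Fin (minpoly ℚ (α : K)).natDegree := finCongr (by rw [hdeg, hr])
  have h2 := h1 (fun i => (c (e.symm i) : ℚ)) (by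
    rw [← e.sum_comp]
    have h3 := congrArg (algebraMap (𝓞 K) K) hc
    simp only [map_sum, map_zero, powers, zsmul_eq_mul, map_mul, map_pow, map_intCast] at h3
    rw [← h3]
    refine Finset.sum_congr rfl fun i _ => ?_
    simp [e, Algebra.smul_def])
  intro i
  have := h2 (e i)
  simpa using this

end Lattice

/-! ### Traces of powers of `θ` and the discriminant of `ℤ[θ]`. -/

section Trace

variable {K : Type*} [Field K] [NumberField K]

theorem trace_eq_sum_repr (B : Module.Basis (Fin 4) ℚ K) (x : K) :
    Algebra.trace ℚ K x = ∑ j, B.repr (x * B j) j := by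
  rw [Algebra.trace_eq_matrix_trace B, Matrix.trace]
  simp [Algebra.leftMulMatrix_eq_repr_mul]

variable {θ : 𝓞 K} {m : ℤ}

theorem trace_one (hr : Module.finrank ℚ K = 4) : Algebra.trace ℤ (𝓞 K) 1 = 4 := by
  have h := Algebra.trace_algebraMap (S := 𝓞 K) (1 : ℤ)
  rw [map_one, NumberField.RingOfIntegers.rank, hr] at h
  simpa using h

theorem trace_intCast (hr : Module.finrank ℚ K = 4) (n : ℤ) :
    Algebra.trace ℤ (𝓞 K) (n : 𝓞 K) = 4 * n := by
  have h := Algebra.trace_algebraMap (S := 𝓞 K) n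
  rw [NumberField.RingOfIntegers.rank, hr] at h
  simpa using h

omit [NumberField K] in
theorem trace_intCast_mul (n : ℤ) (x : 𝓞 K) :
    Algebra.trace ℤ (𝓞 K) (n * x) = n * Algebra.trace ℤ (𝓞 K) x := by
  rw [← zsmul_eq_mul, map_smul, smul_eq_mul]

theorem trace_powers (hr : Module.finrank ℚ K = 4) (hθ : IsPrimitiveInt θ)
    (h : θ ^ 4 = m * θ ^ 3 + 6 * θ ^ 2 - m * θ - 1) :
    Algebra.trace ℤ (𝓞 K) θ = m ∧ Algebra.trace ℤ (𝓞 K) (θ ^ 2) = m ^ 2 + 12 ∧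
      Algebra.trace ℤ (𝓞 K) (θ ^ 3) = m ^ 3 + 15 * m := by
  have hli : LinearIndependent ℚ (fun i : Fin 4 => (θ : K) ^ (i : ℕ)) := by
    have h1 := linearIndependent_pow (K := ℚ) (θ : K)
    have hdeg := (Field.primitive_element_iff_minpoly_natDegree_eq ℚ (θ : K)).1 hθ
    rw [hdeg, hr] at h1
    exact h1
  let B := basisOfLinearIndependentOfCardEqFinrank hli (by rw [hr, Fintype.card_fin])
  have hB : ∀ i, B i = (θ : K) ^ (i : ℕ) := by
    intro i
    simp [B]
  -- The vectors supplied to `hrepr` below are `θ, …, θ⁶` reduced by the quartic relation; each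
  -- trace is the sum of the diagonal coordinates.
  have hrepr : ∀ (x : K) (c : Fin 4 → ℚ) (j : Fin 4),
      x = c 0 + c 1 * θ + c 2 * (θ : K) ^ 2 + c 3 * (θ : K) ^ 3 → B.repr x j = c j := by
    intro x c j hx
    have : x = ∑ i, c i • B i := by
      simp [hx, hB, Fin.sum_univ_four, Algebra.smul_def]
    rw [this, B.repr_sum_self]
  have h4 : (θ : K) ^ 4 = m * (θ : K) ^ 3 + 6 * (θ : K) ^ 2 - m * θ - 1 := by
    have := congrArg (algebraMap (𝓞 K) K) h
    simpa [map_ofNat] using this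
  have hB0 : B 0 = 1 := by simp [hB]
  have hB1 : B 1 = (θ : K) := by simp [hB]
  have hB2 : B 2 = (θ : K) ^ 2 := hB 2
  have hB3 : B 3 = (θ : K) ^ 3 := hB 3
  refine ⟨?_, ?_, ?_⟩
  · rw [← Int.cast_inj (α := ℚ), Algebra.coe_trace_int, trace_eq_sum_repr B, Fin.sum_univ_four]
    simp only [hB0, hB1, hB2, hB3]
    rw [hrepr _ ![0, 1, 0, 0] 0 (by simp), hrepr _ ![0, 0, 1, 0] 1 (by simp; ring),
      hrepr _ ![0, 0, 0, 1] 2 (by simp; ring),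
      hrepr _ ![-1, -m, 6, m] 3 (by simp; linear_combination h4)]
    simp
  · rw [← Int.cast_inj (α := ℚ), Algebra.coe_trace_int, trace_eq_sum_repr B, Fin.sum_univ_four]
    simp only [hB0, hB1, hB2, hB3, map_pow]
    rw [hrepr _ ![0, 0, 1, 0] 0 (by simp), hrepr _ ![0, 0, 0, 1] 1 (by simp; ring),
      hrepr _ ![-1, -m, 6, m] 2 (by simp; linear_combination h4),
      hrepr _ ![-m, -(m ^ 2 + 1), 5 * m, m ^ 2 + 6] 3
        (by simp; linear_combination ((θ : K) + m) * h4)]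
    simp
    ring
  · rw [← Int.cast_inj (α := ℚ), Algebra.coe_trace_int, trace_eq_sum_repr B, Fin.sum_univ_four]
    simp only [hB0, hB1, hB2, hB3, map_pow]
    rw [hrepr _ ![0, 0, 0, 1] 0 (by simp),
      hrepr _ ![-1, -m, 6, m] 1 (by simp; linear_combination h4),
      hrepr _ ![-m, -(m ^ 2 + 1), 5 * m, m ^ 2 + 6] 2
        (by simp; linear_combination ((θ : K) + m) * h4),
      hrepr _ ![-m ^ 2 - 6, -m ^ 3 - 7 * m, 5 * m ^ 2 + 35, m ^ 3 + 11 * m] 3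
        (by simp; linear_combination ((θ : K) ^ 2 + m * θ + m ^ 2 + 6) * h4)]
    simp
    ring

theorem discr_powers (hr : Module.finrank ℚ K = 4) (hθ : IsPrimitiveInt θ)
    (h : θ ^ 4 = m * θ ^ 3 + 6 * θ ^ 2 - m * θ - 1) :
    Algebra.discr ℤ (powers θ) = 4 * (m ^ 2 + 16) ^ 3 := by
  obtain ⟨t1, t2, t3⟩ := trace_powers hr hθ h
  have t0 := trace_one (K := K) hr
  -- The recursion gives the power sums up to `θ⁶`, the entries of the Hankel trace matrix.
  have key : ∀ k, Algebra.trace ℤ (𝓞 K) (θ ^ (k + 4))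
      = m * Algebra.trace ℤ (𝓞 K) (θ ^ (k + 3)) + 6 * Algebra.trace ℤ (𝓞 K) (θ ^ (k + 2))
        - m * Algebra.trace ℤ (𝓞 K) (θ ^ (k + 1)) - Algebra.trace ℤ (𝓞 K) (θ ^ k) := by
    intro k
    have e : θ ^ (k + 4) = (m : ℤ) * θ ^ (k + 3) + (6 : ℤ) * θ ^ (k + 2)
        - (m : ℤ) * θ ^ (k + 1) - θ ^ k := by
      push_cast
      linear_combination θ ^ k * h
    rw [e, map_sub, map_sub, map_add, trace_intCast_mul, trace_intCast_mul, trace_intCast_mul]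
  have t4 := key 0
  have t5 := key 1
  have t6 := key 2
  norm_num [t0, t1, t2, t3] at t4
  norm_num [t0, t1, t2, t3, t4] at t5
  norm_num [t0, t1, t2, t3, t4, t5] at t6
  have hM : Algebra.traceMatrix ℤ (powers θ) = Matrix.of fun i j : Fin 4 =>
      Algebra.trace ℤ (𝓞 K) (θ ^ ((i : ℕ) + (j : ℕ))) := by
    ext i j
    simp [Algebra.traceMatrix_apply, Algebra.traceForm_apply, powers, pow_add]
  rw [Algebra.discr_def, hM]
  simp [Matrix.det_succ_row_zero, Fin.sum_univ_succ, Fin.succAbove, t0, t1, t2, t3, t4, t5, t6]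
  ring

end Trace

/-! ### Odd primes do not divide the index of `θ`. -/

section OddPrimes

variable {K : Type*} [Field K] [NumberField K]

theorem dvd_of_intCast_dvd_intCast {p n : ℤ} (hp : Prime p)
    (h : (p : 𝓞 K) ∣ n) : p ∣ n := by
  have h1 := map_dvd (Algebra.norm ℤ) h
  have h2 : ∀ k : ℤ, Algebra.norm ℤ (k : 𝓞 K) = k ^ Module.finrank ℤ (𝓞 K) := fun k => by
    simpa using Algebra.norm_algebraMap (S := 𝓞 K) k
  rw [h2, h2] at h1
  have h3 : 0 < Module.finrank ℤ (𝓞 K) := Module.finrank_pos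
  exact hp.dvd_of_dvd_pow ((dvd_pow_self p h3.ne').trans h1)

/-- A family of powers of a root of an Eisenstein polynomial at `p` is saturated at `p`. -/
theorem dvd_coeff_of_eisenstein {p : ℤ} (hp : Prime p) {y : 𝓞 K} {a₂ a₁ a₀ : ℤ}
    (hy : y ^ 4 = p * (a₂ * y ^ 2 + a₁ * y + a₀)) (ha₀ : ¬ p ∣ a₀) {c₀ c₁ c₂ c₃ : ℤ}
    (h : (p : 𝓞 K) ∣ c₀ + c₁ * y + c₂ * y ^ 2 + c₃ * y ^ 3) :
    p ∣ c₀ ∧ p ∣ c₁ ∧ p ∣ c₂ ∧ p ∣ c₃ := by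
  have hp0 : (p : 𝓞 K) ≠ 0 := by exact_mod_cast hp.ne_zero
  have h2 : ∀ k : ℤ, Algebra.norm ℤ (k : 𝓞 K) = k ^ Module.finrank ℤ (𝓞 K) := fun k => by
    simpa using Algebra.norm_algebraMap (S := 𝓞 K) k
  have h3 : Module.finrank ℤ (𝓞 K) ≠ 0 := Module.finrank_pos.ne'
  have hN : p ∣ Algebra.norm ℤ y := by
    have h1 := map_dvd (Algebra.norm ℤ) (Dvd.intro _ hy.symm)
    rw [h2, map_pow] at h1
    exact hp.dvd_of_dvd_pow ((dvd_pow_self p h3).trans h1)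
  have hdvd : ∀ c : ℤ, y ∣ (c : 𝓞 K) → p ∣ c := by
    intro c hc
    have h1 := map_dvd (Algebra.norm ℤ) hc
    rw [h2] at h1
    exact hp.dvd_of_dvd_pow (hN.trans h1)
  -- Multiplying `c y³ = p z` by `y` and cancelling `p` shows that `y` divides `c a₀`; the norm of
  -- `y` is divisible by `p`, whence `p ∣ c a₀`.
  have hcube : ∀ c : ℤ, (p : 𝓞 K) ∣ c * y ^ 3 → p ∣ c := by
    rintro c ⟨z, hz⟩
    have h1 : (c : 𝓞 K) * (a₂ * y ^ 2 + a₁ * y + a₀) = z * y := by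
      apply mul_left_cancel₀ hp0
      linear_combination y * hz - (c : 𝓞 K) * hy
    have h4 : p ∣ c * a₀ := hdvd _ ⟨z - c * a₂ * y - c * a₁, by
      push_cast
      linear_combination h1⟩
    exact (hp.dvd_or_dvd h4).resolve_right ha₀
  have hc0 : p ∣ c₀ := by
    obtain ⟨z, hz⟩ := h
    -- Here `p a₀ = y⁴ - p y (a₂ y + a₁)` is a multiple of `y`, and `c₀` is a multiple of `y` plus a
    -- multiple of `p`.
    have h4 : p ∣ c₀ * a₀ := hdvd _ ⟨z * (y ^ 3 - p * (a₂ * y + a₁))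
        - a₀ * (c₁ + c₂ * y + c₃ * y ^ 2), by
      push_cast
      linear_combination (a₀ : 𝓞 K) * hz - z * hy⟩
    exact (hp.dvd_or_dvd h4).resolve_right ha₀
  have hp4 : (p : 𝓞 K) ∣ y ^ 4 := Dvd.intro _ hy.symm
  have hc0' : (p : 𝓞 K) ∣ c₀ := by exact_mod_cast map_dvd (Int.castRingHom (𝓞 K)) hc0
  have e1 : (p : 𝓞 K) ∣ c₁ * y + c₂ * y ^ 2 + c₃ * y ^ 3 := by
    convert h.sub hc0' using 1
    ring
  have hc1 : p ∣ c₁ := by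
    apply hcube
    convert (e1.mul_left (y ^ 2)).sub (hp4.mul_left (c₂ + c₃ * y)) using 1
    ring
  have hc1' : (p : 𝓞 K) ∣ c₁ := by exact_mod_cast map_dvd (Int.castRingHom (𝓞 K)) hc1
  have e2 : (p : 𝓞 K) ∣ c₂ * y ^ 2 + c₃ * y ^ 3 := by
    convert e1.sub (hc1'.mul_right y) using 1
    ring
  have hc2 : p ∣ c₂ := by
    apply hcube
    convert (e2.mul_left y).sub (hp4.mul_left (c₃ : 𝓞 K)) using 1
    ring
  have hc2' : (p : 𝓞 K) ∣ c₂ := by exact_mod_cast map_dvd (Int.castRingHom (𝓞 K)) hc2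
  refine ⟨hc0, hc1, hc2, hcube _ ?_⟩
  convert e2.sub (hc2'.mul_right (y ^ 2)) using 1
  ring

omit [NumberField K] in
theorem sum_smul_powers (α : 𝓞 K) (c : Fin 4 → ℤ) :
    ∑ i, c i • powers α i = c 0 + c 1 * α + c 2 * α ^ 2 + c 3 * α ^ 3 := by
  simp [Fin.sum_univ_four, powers]

variable (b : Module.Basis (Fin 4) ℤ (𝓞 K)) {θ : 𝓞 K} {m : ℤ}

theorem four_mul_cube_eq (hθ : IsPrimitiveInt θ)
    (h : θ ^ 4 = m * θ ^ 3 + 6 * θ ^ 2 - m * θ - 1) :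
    4 * (m ^ 2 + 16) ^ 3 = b.det (powers θ) ^ 2 * Algebra.discr ℤ b := by
  rw [← discr_eq_det_sq_mul, discr_powers (finrank_eq_four_of_basis b) hθ h]

theorem not_dvd_det_powers_of_odd (hθ : IsPrimitiveInt θ)
    (h : θ ^ 4 = m * θ ^ 3 + 6 * θ ^ 2 - m * θ - 1)
    (hsq : ∀ d : ℤ, Odd d → d ^ 2 ∣ m ^ 2 + 16 → IsUnit d)
    {p : ℕ} (hp : p.Prime) (hp2 : p ≠ 2) : ¬ (p : ℤ) ∣ b.det (powers θ) := by
  intro hdvd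
  have hpZ : Prime (p : ℤ) := Nat.prime_iff_prime_int.1 hp
  have hpodd : Odd (p : ℤ) := by exact_mod_cast hp.odd_of_ne_two hp2
  have h2 : ¬ (p : ℤ) ∣ 2 := by
    intro h2
    have := (Nat.prime_dvd_prime_iff_eq hp Nat.prime_two).1 (by exact_mod_cast h2)
    exact hp2 this
  have hpow : ∀ {k : ℕ}, ¬ (p : ℤ) ∣ 2 ^ k := fun hk => h2 (hpZ.dvd_of_dvd_pow hk)
  have hD : (p : ℤ) ∣ m ^ 2 + 16 := by
    have h1 : (p : ℤ) ∣ 4 * (m ^ 2 + 16) ^ 3 := by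
      rw [four_mul_cube_eq b hθ h]
      exact (hdvd.trans (dvd_pow_self _ two_ne_zero)).mul_right _
    refine hpZ.dvd_of_dvd_pow ((hpZ.dvd_or_dvd h1).resolve_left ?_)
    exact hpow (k := 2)
  obtain ⟨D', hD'⟩ := hD
  have hD'p : ¬ (p : ℤ) ∣ D' := by
    rintro ⟨k, rfl⟩
    exact hpZ.not_isUnit (hsq p hpodd ⟨k, by rw [hD']; ring⟩)
  have : Fact p.Prime := ⟨hp⟩
  refine not_dvd_det_of_saturated b ?_ hdvd
  intro c hc
  have hD'' : (m : 𝓞 K) ^ 2 + 16 = p * D' := by exact_mod_cast congrArg (Int.cast (R := 𝓞 K)) hD'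
  -- `4θ - m` has no cubic term; its remaining coefficients are multiples of `m² + 16 = p D'`.
  have hy : (4 * θ - m) ^ 4 = ((p : ℤ) : 𝓞 K) * (((6 * D' : ℤ) : 𝓞 K) * (4 * θ - m) ^ 2
      + ((8 * m * D' : ℤ) : 𝓞 K) * (4 * θ - m) + (((3 * m ^ 2 - 16) * D' : ℤ) : 𝓞 K)) := by
    push_cast
    linear_combination 256 * h + (6 * (4 * θ - m) ^ 2 + 8 * m * (4 * θ - m)
      + (3 * (m : 𝓞 K) ^ 2 - 16)) * hD''
  have ha₀ : ¬ (p : ℤ) ∣ (3 * m ^ 2 - 16) * D' := by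
    intro h0
    have h1 := (hpZ.dvd_or_dvd h0).resolve_right hD'p
    have h3 : (p : ℤ) ∣ 2 ^ 6 := by
      have : (2 : ℤ) ^ 6 = 3 * (m ^ 2 + 16) - (3 * m ^ 2 - 16) := by ring
      rw [this]
      exact ((Dvd.intro _ hD'.symm).mul_left 3).sub h1
    exact hpow h3
  obtain ⟨h0, h1, h2', h3⟩ := dvd_coeff_of_eisenstein hpZ hy ha₀
    -- Coefficients of `64 ∑ cᵢ θⁱ` in powers of `4θ - m`; the system is triangular with powers of 2
    -- on the diagonal.
    (c₀ := 64 * c 0 + 16 * m * c 1 + 4 * m ^ 2 * c 2 + m ^ 3 * c 3)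
    (c₁ := 16 * c 1 + 8 * m * c 2 + 3 * m ^ 2 * c 3) (c₂ := 4 * c 2 + 3 * m * c 3) (c₃ := c 3) (by
      have hc' := hc.mul_left 64
      convert hc' using 1
      · simp
      rw [sum_smul_powers]
      push_cast
      ring)
  have k2 : (p : ℤ) ∣ c 2 := by
    have : (p : ℤ) ∣ 2 ^ 2 * c 2 := by
      have e : 2 ^ 2 * c 2 = 4 * c 2 + 3 * m * c 3 - 3 * m * c 3 := by ring
      rw [e]
      exact h2'.sub (h3.mul_left (3 * m))
    exact (hpZ.dvd_or_dvd this).resolve_left hpow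
  have k1 : (p : ℤ) ∣ c 1 := by
    have : (p : ℤ) ∣ 2 ^ 4 * c 1 := by
      have e : 2 ^ 4 * c 1 = 16 * c 1 + 8 * m * c 2 + 3 * m ^ 2 * c 3 - 3 * m ^ 2 * c 3
          - 8 * m * c 2 := by ring
      rw [e]
      exact (h1.sub (h3.mul_left (3 * m ^ 2))).sub (k2.mul_left (8 * m))
    exact (hpZ.dvd_or_dvd this).resolve_left hpow
  have k0 : (p : ℤ) ∣ c 0 := by
    have : (p : ℤ) ∣ 2 ^ 6 * c 0 := by
      have e : 2 ^ 6 * c 0 = 64 * c 0 + 16 * m * c 1 + 4 * m ^ 2 * c 2 + m ^ 3 * c 3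
          - m ^ 3 * c 3 - 4 * m ^ 2 * c 2 - 16 * m * c 1 := by ring
      rw [e]
      exact ((h0.sub (h3.mul_left (m ^ 3))).sub (k2.mul_left (4 * m ^ 2))).sub
        (k1.mul_left (16 * m))
    exact (hpZ.dvd_or_dvd this).resolve_left hpow
  intro i
  fin_cases i
  exacts [k0, k1, k2, h3]

theorem not_four_dvd_det_powers (hθ : IsPrimitiveInt θ)
    (h : θ ^ 4 = m * θ ^ 3 + 6 * θ ^ 2 - m * θ - 1) (hm : Odd m) :
    ¬ 4 ∣ b.det (powers θ) := by
  rintro ⟨k, hk⟩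
  have h1 := four_mul_cube_eq b hθ h
  rw [hk] at h1
  have h2 : Odd ((m ^ 2 + 16) ^ 3) := ((hm.pow).add_even (by decide)).pow
  obtain ⟨r, hr⟩ := h2
  rw [hr] at h1
  have h3 : 2 * r + 1 = 4 * (k ^ 2 * Algebra.discr ℤ b) := by linarith
  omega

end OddPrimes

/-! ### A local criterion at 2 and odd values of characteristic polynomials. -/

section EvenIndex

variable {K : Type*} [Field K] [NumberField K]

theorem int_two_dvd_of_two_dvd {n : ℤ} (h : (2 : 𝓞 K) ∣ n) : 2 ∣ n :=
  dvd_of_intCast_dvd_intCast (K := K) Int.prime_two (by simpa using h)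

theorem not_two_dvd_one : ¬ (2 : 𝓞 K) ∣ 1 := by
  intro h
  have := int_two_dvd_of_two_dvd (K := K) (n := 1) (by simpa using h)
  omega

/-- If `x² = 2ax + 4c`, then `x / 2` is integral. -/
theorem two_dvd_of_sq_eq {x a c : 𝓞 K} (h : x ^ 2 = 2 * a * x + 4 * c) : ∃ y, x = 2 * y := by
  have hint : IsIntegral (𝓞 K) ((x : K) / 2) := by
    refine ⟨X ^ 2 - C a * X - C c, by monicity!, ?_⟩
    have h' : (x : K) ^ 2 = 2 * a * x + 4 * c := by
      have := congrArg (algebraMap (𝓞 K) K) h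
      simpa [map_ofNat] using this
    simp
    linear_combination h' / 4
  obtain ⟨y, hy⟩ := IsIntegrallyClosed.isIntegral_iff.1 hint
  refine ⟨y, NumberField.RingOfIntegers.coe_injective ?_⟩
  rw [map_mul, hy, map_ofNat]
  ring

/-- A local criterion at `2`: the ring generated by `β` is saturated at `2` if some
`τ = β² + pβ + q` has square `2` up to a unit, and `β`, `β + 1` are not too divisible. -/
theorem even_coeffs_of_two_dvd {β τ ξ : 𝓞 K} {p q : ℤ} (hτ : τ = β ^ 2 + p * β + q)
    (h2 : 2 ∣ τ ^ 2) (hξ : 4 ∣ τ ^ 2 * ξ - 2) (h0 : ¬ 2 ∣ β ^ 2) (h1 : ¬ 2 ∣ (β + 1) ^ 2)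
    (c : Fin 4 → ℤ) (hc : 2 ∣ ∑ i, c i • powers β i) (i : Fin 4) : 2 ∣ c i := by
  have two0 : (2 : 𝓞 K) ≠ 0 := two_ne_zero
  -- Unless both coefficients are even, the square is 1, `β²` or `(1 + β)²` mod 2.
  have hlin : ∀ b₀ b₁ : ℤ, (2 : 𝓞 K) ∣ (b₀ + b₁ * β) ^ 2 → 2 ∣ b₀ ∧ 2 ∣ b₁ := by
    rintro b₀ b₁ ⟨z, hz⟩
    rcases Int.even_or_odd' b₀ with ⟨k, rfl | rfl⟩ <;> rcases Int.even_or_odd' b₁ with ⟨l, rfl | rfl⟩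
    · exact ⟨⟨k, rfl⟩, ⟨l, rfl⟩⟩
    · refine absurd ⟨z - 2 * (k + l * β) ^ 2 - 2 * (k + l * β) * β, ?_⟩ h0
      push_cast at hz
      linear_combination hz
    · refine absurd ⟨z - 2 * (k + l * β) ^ 2 - 2 * (k + l * β), ?_⟩ (not_two_dvd_one (K := K))
      push_cast at hz
      linear_combination hz
    · refine absurd ⟨z - 2 * (k + l * β) ^ 2 - 2 * (k + l * β) * (1 + β), ?_⟩ h1
      push_cast at hz
      linear_combination hz
  obtain ⟨w, hw⟩ := hξ
  obtain ⟨t, ht⟩ := h2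
  -- If `xτ = 2s`, then `x²τ² = 4s²`; multiplying by `ξ` turns `τ²` into twice an odd element, so a
  -- factor 2 is left in `x²`.
  have hmul : ∀ x : 𝓞 K, 2 ∣ x * τ → 2 ∣ x ^ 2 := by
    rintro x ⟨s, hs⟩
    refine ⟨s ^ 2 * ξ - x ^ 2 * w, mul_left_cancel₀ two0 ?_⟩
    linear_combination ξ * (x * τ + 2 * s) * hs - x ^ 2 * hw
  obtain ⟨z, hz⟩ := hc
  rw [sum_smul_powers] at hz
  obtain ⟨k, hk⟩ : ∃ k : ℤ, k = c 2 - p * c 3 := ⟨_, rfl⟩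
  have hk' : (k : 𝓞 K) = c 2 - p * c 3 := by rw [hk]; push_cast; ring
  -- Division by `τ` in powers of `β`. Multiplying by `τ` isolates the remainder mod 2, as `2 ∣ τ²`;
  -- the quotient follows.
  have hsum : ((c 0 - q * k : ℤ) + (c 1 - q * c 3 - p * k : ℤ) * β) + (k + c 3 * β) * τ
      = 2 * z := by
    rw [← hz, hτ]
    push_cast
    linear_combination (β ^ 2) * hk'
  obtain ⟨⟨r₀, hr₀⟩, ⟨r₁, hr₁⟩⟩ := hlin _ _ (hmul ((c 0 - q * k : ℤ) + (c 1 - q * c 3 - p * k : ℤ) * β) ⟨z * τ - (k + c 3 * β) * t, by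
    linear_combination τ * hsum - (k + c 3 * β) * ht⟩)
  obtain ⟨hk2, h3⟩ := hlin _ _ (hmul (k + c 3 * β) ⟨z - r₀ - r₁ * β, by
    rw [hr₀, hr₁] at hsum
    push_cast at hsum
    linear_combination hsum⟩)
  obtain ⟨a, rfl⟩ := hk2
  obtain ⟨d, hd⟩ := h3
  have e2 : 2 ∣ c 2 := ⟨a + p * d, by linear_combination -hk + p * hd⟩
  have e1 : 2 ∣ c 1 := ⟨r₁ + q * d + p * a, by linear_combination hr₁ + q * hd⟩
  have e0 : 2 ∣ c 0 := ⟨r₀ + q * a, by linear_combination hr₀⟩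
  fin_cases i
  exacts [e0, e1, e2, ⟨d, hd⟩]

omit [NumberField K] in
/-- Every element is, modulo `2`, congruent to one with a small square. -/
theorem exists_sq_eq (b : Module.Basis (Fin 4) ℤ (𝓞 K)) {β τ : 𝓞 K} {p q : ℤ}
    (hτ : τ = β ^ 2 + p * β + q) (h2 : 2 ∣ τ ^ 2) (hdet : ¬ 2 ∣ b.det (powers β)) (α : 𝓞 K) :
    ∃ b₀ b₁ : ℤ, 2 ∣ α ^ 2 - (b₀ + b₁ * β ^ 2) := by
  obtain ⟨c, hc⟩ := det_smul_mem_span b (powers β) α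
  rw [sum_smul_powers, zsmul_eq_mul] at hc
  obtain ⟨k, hk⟩ := (Int.not_even_iff_odd.1 (fun h => hdet h.two_dvd) : Odd (b.det (powers β)))
  rw [hk] at hc
  push_cast at hc
  obtain ⟨t, ht⟩ := h2
  obtain ⟨a, ha⟩ : ∃ a : ℤ, a = c 2 - p * c 3 := ⟨_, rfl⟩
  have ha' : (a : 𝓞 K) = c 2 - p * c 3 := by rw [ha]; push_cast; ring
  obtain ⟨b₀, hb₀⟩ : ∃ b₀ : ℤ, b₀ = c 0 - q * a := ⟨_, rfl⟩
  obtain ⟨b₁, hb₁⟩ : ∃ b₁ : ℤ, b₁ = c 1 - q * c 3 - p * a := ⟨_, rfl⟩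
  have hb₀' : (b₀ : 𝓞 K) = c 0 - q * a := by rw [hb₀]; push_cast; ring
  have hb₁' : (b₁ : 𝓞 K) = c 1 - q * c 3 - p * a := by rw [hb₁]; push_cast; ring
  have hα : α = b₀ + b₁ * β + (a + c 3 * β) * τ - 2 * (k * α) := by
    rw [hτ, hb₀', hb₁']
    linear_combination hc - β ^ 2 * ha'
  refine ⟨b₀ ^ 2, b₁ ^ 2, b₀ * b₁ * β + (b₀ + b₁ * β) * (a + c 3 * β) * τ
    + (a + c 3 * β) ^ 2 * t - 2 * (k * α) * (b₀ + b₁ * β + (a + c 3 * β) * τ)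
    + 2 * (k * α) ^ 2, ?_⟩
  push_cast
  linear_combination (α + (b₀ + b₁ * β + (a + c 3 * β) * τ - 2 * (k * α))) * hα
    + (a + c 3 * β) ^ 2 * ht

theorem odd_norm_of_two_dvd_sub_one {x y : 𝓞 K} (h : 2 ∣ x * y - 1) :
    ¬ 2 ∣ Algebra.norm ℤ x := by
  obtain ⟨z, hz⟩ := h
  intro hx
  have h1 := norm_add_mul_modEq (1 : 𝓞 K) z 2
  have h2 : (1 : 𝓞 K) + (2 : ℕ) * z = x * y := by
    push_cast
    linear_combination -hz
  rw [h2, map_mul, map_one] at h1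
  have h3 : ((Algebra.norm ℤ x * Algebra.norm ℤ y : ℤ) : ZMod 2) = 0 :=
    (ZMod.intCast_zmod_eq_zero_iff_dvd _ 2).2 (hx.mul_right _)
  rw [h3] at h1
  simp at h1

theorem not_two_dvd_valueGcd {α y : 𝓞 K} (h : 2 ∣ α * y - 1 ∨ 2 ∣ (1 - α) * y - 1) :
    ¬ 2 ∣ valueGcd α := by
  intro hdvd
  have key : ∀ x : ℤ, 2 ∣ Algebra.norm ℤ ((x : 𝓞 K) - α) := by
    intro x
    rw [← eval_intCharpoly]
    exact (Int.natCast_dvd_natCast.2 hdvd).trans (valueGcd_dvd α x)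
  rcases h with h | h
  · have h0 := key 0
    have e : (((0 : ℤ) : 𝓞 K) - α) * (-y) - 1 = α * y - 1 := by push_cast; ring
    exact odd_norm_of_two_dvd_sub_one (e ▸ h) h0
  · have h0 := key 1
    rw [Int.cast_one] at h0
    exact odd_norm_of_two_dvd_sub_one h h0

/-- If there is a single prime above `2`, then `i(α)` is odd for every `α`. -/
theorem not_two_dvd_valueGcd_of_local (b : Module.Basis (Fin 4) ℤ (𝓞 K)) {β τ : 𝓞 K} {p q : ℤ}
    (hτ : τ = β ^ 2 + p * β + q) (h2 : 2 ∣ τ ^ 2) (hdet : ¬ 2 ∣ b.det (powers β))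
    (h4 : 2 ∣ β ^ 4 ∨ 2 ∣ β ^ 4 - (β ^ 2 + 1)) (α : 𝓞 K) : ¬ 2 ∣ valueGcd α := by
  obtain ⟨b₀, b₁, z, hz⟩ := exists_sq_eq b hτ h2 hdet α
  -- Squaring `α² ≡ b₀ + b₁β²` mod 2 gives an integer when `b₁` is even or `β⁴ ≡ 0`. Otherwise
  -- `α²(α² + 1) ≡ b₀² + b₀ + β² + β⁴ ≡ 1`, so `α` is invertible mod 2.
  have main : (∃ k : ℤ, 2 ∣ α ^ 4 - k) ∨ ∃ y, 2 ∣ α * y - 1 := by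
    rcases Int.even_or_odd' b₁ with ⟨l, rfl | rfl⟩
    · left
      refine ⟨b₀ ^ 2, z * (α ^ 2 + b₀ + 2 * l * β ^ 2) + l * β ^ 2 * (2 * b₀ + 2 * l * β ^ 2), ?_⟩
      push_cast at hz ⊢
      linear_combination (α ^ 2 + b₀ + 2 * l * β ^ 2) * hz
    · rcases h4 with ⟨s, hs⟩ | ⟨s, hs⟩
      · left
        refine ⟨b₀ ^ 2, z * (α ^ 2 + b₀ + (2 * l + 1) * β ^ 2)
          + b₀ * (2 * l + 1) * β ^ 2 + (2 * l + 1) ^ 2 * s, ?_⟩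
        push_cast at hz ⊢
        linear_combination (α ^ 2 + b₀ + (2 * l + 1) * β ^ 2) * hz + (2 * l + 1) ^ 2 * hs
      · right
        obtain ⟨r, hr⟩ : ∃ r : ℤ, (b₀ : ℤ) ^ 2 + b₀ = 2 * r := by
          obtain ⟨r, hr⟩ := Int.even_mul_succ_self b₀
          exact ⟨r, by linarith⟩
        have hr' : (b₀ : 𝓞 K) ^ 2 + b₀ = 2 * r := by exact_mod_cast congrArg (Int.cast (R := 𝓞 K)) hr
        push_cast at hz
        have hz' : α ^ 2 = b₀ + β ^ 2 + 2 * (z + l * β ^ 2) := by linear_combination hz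
        generalize z + l * β ^ 2 = v at hz'
        refine ⟨α * (α ^ 2 + 1), r + b₀ * β ^ 2 + β ^ 2 + s
          + v * (2 * (b₀ + β ^ 2) + 1 + 2 * v), ?_⟩
        linear_combination (α ^ 2 + 1 + b₀ + β ^ 2 + 2 * v) * hz' + hr' + hs
  rcases main with ⟨k, y, hy⟩ | ⟨y, hy⟩
  · rcases Int.even_or_odd' k with ⟨l, rfl | rfl⟩
    · refine not_two_dvd_valueGcd (y := (1 - α) ^ 3) (Or.inr ⟨y + l - 2 * α + 3 * α ^ 2
        - 2 * α ^ 3, ?_⟩)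
      push_cast at hy
      linear_combination hy
    · refine not_two_dvd_valueGcd (y := α ^ 3) (Or.inl ⟨y + l, ?_⟩)
      push_cast at hy
      linear_combination hy
  · exact not_two_dvd_valueGcd (Or.inl hy)

end EvenIndex

/-! ### Local generators at 2 for even `m`, by the 2-adic valuation of `m`. -/

section Cases

variable {K : Type*} [Field K] [NumberField K] {θ : 𝓞 K}

/-- Data describing a generator of the maximal order at `2`. -/
structure IsLocalGenerator (β τ ξ : 𝓞 K) (p q : ℤ) : Prop where
  eq : τ = β ^ 2 + p * β + q
  two_dvd : 2 ∣ τ ^ 2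
  four_dvd : 4 ∣ τ ^ 2 * ξ - 2
  not_dvd : ¬ 2 ∣ β ^ 2
  not_dvd' : ¬ 2 ∣ (β + 1) ^ 2

theorem IsLocalGenerator.not_two_dvd_det {β τ ξ : 𝓞 K} {p q : ℤ}
    (h : IsLocalGenerator β τ ξ p q) (b : Module.Basis (Fin 4) ℤ (𝓞 K)) :
    ¬ 2 ∣ b.det (powers β) :=
  not_dvd_det_of_saturated (p := 2) b fun c hc i =>
    even_coeffs_of_two_dvd h.eq h.two_dvd h.four_dvd h.not_dvd h.not_dvd' c
      (by simpa using hc) i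

/-- Half of `θ - 1/θ` is integral when `m = 2n` is even. -/
theorem exists_half {n : ℤ}
    (h : θ ^ 4 = (2 * n : ℤ) * θ ^ 3 + 6 * θ ^ 2 - (2 * n : ℤ) * θ - 1) :
    ∃ w : 𝓞 K, w ^ 2 = n * w + 1 ∧ θ ^ 2 = 2 * w * θ + 1 ∧
      2 * w = θ ^ 3 - 2 * n * θ ^ 2 - 5 * θ + 2 * n := by
  push_cast at h
  -- This cubic in `θ` is `u = θ - θ⁻¹`.
  obtain ⟨w, hw⟩ := two_dvd_of_sq_eq (x := θ ^ 3 - 2 * (n : 𝓞 K) * θ ^ 2 - 5 * θ + 2 * (n : 𝓞 K))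
    (a := (n : 𝓞 K)) (c := 1) (by
      linear_combination (θ ^ 2 - 2 * n * θ - 4) * h)
  refine ⟨w, ?_, ?_, hw.symm⟩
  · have h4 : (4 : 𝓞 K) ≠ 0 := by norm_num
    apply mul_left_cancel₀ h4
    linear_combination (θ ^ 2 - 2 * n * θ - 4) * h - (2 * w + (θ ^ 3 - 2 * n * θ ^ 2 - 5 * θ + 2 * n) - 2 * n) * hw
  · linear_combination θ * hw - h

/-- Here 2 is inert in `k`, and `β = θ - w` satisfies `β⁴ ≡ β² + 1` mod 2; thus `β² + β + 1` has
square 2 up to a unit at 2. -/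
theorem exists_isLocalGenerator_of_two_mul_odd {n : ℤ} (hn : Odd n)
    (h : θ ^ 4 = (2 * n : ℤ) * θ ^ 3 + 6 * θ ^ 2 - (2 * n : ℤ) * θ - 1) :
    ∃ (β τ ξ : 𝓞 K) (p q : ℤ), IsLocalGenerator β τ ξ p q ∧ 2 ∣ β ^ 4 - (β ^ 2 + 1) := by
  obtain ⟨w, hw, hθ, -⟩ := exists_half h
  obtain ⟨k, hk⟩ : ∃ k : ℤ, n ^ 2 + 4 = 4 * k + 1 := by
    obtain ⟨l, rfl⟩ := hn
    exact ⟨l ^ 2 + l + 1, by ring⟩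
  have hk' : (n : 𝓞 K) ^ 2 + 4 = 4 * k + 1 := by exact_mod_cast congrArg (Int.cast (R := 𝓞 K)) hk
  have hβ2 : (θ - w) ^ 2 = n * w + 2 := by linear_combination hθ + hw
  generalize θ - w = β at hβ2
  have hβ4 : β ^ 4 = (4 * k + 1) * β ^ 2 - (4 * k + 1) := by
    rw [← hk']
    linear_combination (β ^ 2 + n * w + 2 - (n : 𝓞 K) ^ 2 - 4) * hβ2 + (n : 𝓞 K) ^ 2 * hw
  refine ⟨β, β ^ 2 + β + 1, β, 1, 1, ⟨by push_cast; ring,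
    ⟨β ^ 3 + β + 2 * (k + 1) * β ^ 2 - 2 * k, by linear_combination hβ4⟩,
    ⟨(2 * k + 1) * β ^ 2 - 2 * k + (k + 1) * β ^ 3 - k * β - 1, ?_⟩, ?_, ?_⟩, ⟨2 * k * β ^ 2 - 2 * k - 1, ?_⟩⟩
  · linear_combination (β + 2) * hβ4
  · rintro ⟨z, hz⟩
    refine not_two_dvd_one (K := K) ⟨(4 * k + 1 - β ^ 2) * z - 2 * k, ?_⟩
    linear_combination hβ4 + (4 * k + 1 - β ^ 2) * hz
  · rintro ⟨z, hz⟩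
    obtain ⟨y, hy⟩ : ∃ y, β ^ 2 = 1 + 2 * y := ⟨z - β - 1, by linear_combination hz⟩
    refine not_two_dvd_one (K := K) ⟨(4 * k + 1) * y - 2 * y - 2 * y ^ 2, ?_⟩
    linear_combination hβ4 + (4 * k + 1 - β ^ 2 - 1 - 2 * y) * hy
  · linear_combination hβ4

/-- Here 2 is totally ramified: `(w - j)² = 2d` with `d` odd, and `β = (θ - w)(w - j)/2` is a root
of an Eisenstein quartic at 2. -/
theorem exists_isLocalGenerator_of_four_mul_odd {j : ℤ} (hj : Odd j)
    (h : θ ^ 4 = (2 * (2 * j) : ℤ) * θ ^ 3 + 6 * θ ^ 2 - (2 * (2 * j) : ℤ) * θ - 1) :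
    ∃ (β τ ξ : 𝓞 K) (p q : ℤ), IsLocalGenerator β τ ξ p q ∧ 2 ∣ β ^ 4 := by
  obtain ⟨w, hw, hθ, -⟩ := exists_half h
  push_cast at hw
  obtain ⟨d, hd, l, hl⟩ : ∃ d : ℤ, j ^ 2 + 1 = 2 * d ∧ ∃ l, d = 2 * l + 1 := by
    obtain ⟨l, rfl⟩ := hj
    exact ⟨2 * (l ^ 2 + l) + 1, by ring, l ^ 2 + l, by ring⟩
  have hd' : (j : 𝓞 K) ^ 2 + 1 = 2 * d := by exact_mod_cast congrArg (Int.cast (R := 𝓞 K)) hd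
  have hl' : (d : 𝓞 K) = 2 * l + 1 := by exact_mod_cast congrArg (Int.cast (R := 𝓞 K)) hl
  have hδ : (θ - w) ^ 2 = 2 * (w - j) * w := by linear_combination hθ - hw
  have hs : (w - j) ^ 2 = 2 * d := by linear_combination hw + hd'
  obtain ⟨β, hβ⟩ := two_dvd_of_sq_eq (x := (θ - w) * (w - (j : 𝓞 K))) (a := 0)
    (c := (d : 𝓞 K) * (w - (j : 𝓞 K)) * w)
    (by linear_combination (w - j) ^ 2 * hδ + 2 * (w - j) * w * hs)
  have h4 : (4 : 𝓞 K) ≠ 0 := by norm_num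
  have hβ2 : β ^ 2 = d * (2 * d + j * (w - j)) := by
    apply mul_left_cancel₀ h4
    linear_combination (w - j) ^ 2 * hδ + 2 * (w - j) * w * hs
      - (2 * β + (θ - w) * (w - j)) * hβ + 4 * d * hs
  have hβ4 : β ^ 4 = 4 * d ^ 2 * β ^ 2 - 2 * d ^ 3 := by
    linear_combination (β ^ 2 - 4 * d ^ 2 + d * (2 * d + j * (w - j))) * hβ2
      + d ^ 2 * j ^ 2 * hs + 2 * d ^ 3 * hd'
  refine ⟨β, β ^ 2, 1, 0, 0, ⟨by push_cast; ring, ⟨2 * d ^ 2 * β ^ 2 - d ^ 3,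
    by linear_combination hβ4⟩, ⟨d ^ 2 * β ^ 2 - (4 * l ^ 3 + 6 * l ^ 2 + 3 * l + 1), ?_⟩, ?_, ?_⟩,
    ⟨2 * d ^ 2 * β ^ 2 - d ^ 3, by linear_combination hβ4⟩⟩
  · linear_combination hβ4 - 2 * ((d : 𝓞 K) ^ 2 + d * (2 * l + 1) + (2 * l + 1) ^ 2) * hl'
  · rintro ⟨z, hz⟩
    refine not_two_dvd_one (K := K) ⟨2 * d ^ 2 * z - z ^ 2 - (4 * l ^ 3 + 6 * l ^ 2 + 3 * l), ?_⟩
    apply mul_left_cancel₀ (two_ne_zero (α := 𝓞 K))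
    linear_combination hβ4 - 2 * ((d : 𝓞 K) ^ 2 + d * (2 * l + 1) + (2 * l + 1) ^ 2) * hl'
      + (4 * d ^ 2 - β ^ 2 - 2 * z) * hz
  · rintro ⟨z, hz⟩
    obtain ⟨y, hy⟩ : ∃ y, β ^ 2 = 1 + 2 * y := ⟨z - β - 1, by linear_combination hz⟩
    refine not_two_dvd_one (K := K) ⟨2 * d ^ 2 * β ^ 2 - d ^ 3 - 2 * y - 2 * y ^ 2, ?_⟩
    linear_combination hβ4 - (β ^ 2 + 1 + 2 * y) * hy

/-- For odd `j`, `2 ∣ e²` makes `e ≡ 1` mod 2, a contradiction. For even `j` it makes `e = 2y` with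
`y` of trace 1, while `y = 2y² - 2k²` has even trace. -/
theorem not_two_dvd_sq_of_trace {e : 𝓞 K} {j : ℤ} (hr : Module.finrank ℚ K = 4)
    (he : e ^ 2 = e + j ^ 2) (ht : Algebra.trace ℤ (𝓞 K) e = 2) : ¬ 2 ∣ e ^ 2 := by
  rintro ⟨z, hz⟩
  rcases Int.even_or_odd' j with ⟨k, rfl | rfl⟩
  · push_cast at he
    obtain ⟨y, hy⟩ : ∃ y, e = 2 * y := ⟨z - 2 * k ^ 2, by linear_combination hz - he⟩
    have h1 : ((2 : ℤ) : 𝓞 K) * y ^ 2 = y + ((2 * k ^ 2 : ℤ) : 𝓞 K) := by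
      push_cast
      apply mul_left_cancel₀ (two_ne_zero (α := 𝓞 K))
      linear_combination he - (e + 2 * y - 1) * hy
    have h2 := congrArg (Algebra.trace ℤ (𝓞 K)) h1
    rw [trace_intCast_mul, map_add, trace_intCast hr] at h2
    have h3 : e = ((2 : ℤ) : 𝓞 K) * y := by rw [hy]; push_cast; ring
    rw [h3, trace_intCast_mul] at ht
    omega
  · push_cast at he
    have h' : e = 2 * z - (2 * k + 1) ^ 2 := by linear_combination hz - he
    refine not_two_dvd_one (K := K) ⟨z - 2 * z ^ 2 + 2 * z * (2 * k + 1) ^ 2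
      - 4 * (k ^ 2 + k) - 8 * (k ^ 2 + k) ^ 2, ?_⟩
    linear_combination hz - (e + 2 * z - (2 * k + 1) ^ 2) * h'

/-- Now 2 is unramified in `k`: `e = (1 + w - 2j)/2` satisfies `e² = e + j²`. The element `δ = θ -
w` has `δ² ≡ 2` mod 4, and `β = δ + e` combines residue and ramification. -/
theorem exists_isLocalGenerator_of_eight_mul (hr : Module.finrank ℚ K = 4)
    (hθp : IsPrimitiveInt θ) {j : ℤ}
    (h : θ ^ 4 = (2 * (4 * j) : ℤ) * θ ^ 3 + 6 * θ ^ 2 - (2 * (4 * j) : ℤ) * θ - 1) :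
    ∃ (β τ ξ : 𝓞 K) (p q : ℤ), IsLocalGenerator β τ ξ p q ∧
      (Odd j → 2 ∣ β ^ 4 - (β ^ 2 + 1)) := by
  obtain ⟨w, hw, hθ, hwθ⟩ := exists_half h
  obtain ⟨t1, t2, t3⟩ := trace_powers hr hθp h
  have t0 := trace_one (K := K) hr
  have htw : Algebra.trace ℤ (𝓞 K) w = 8 * j := by
    have e : ((2 : ℤ) : 𝓞 K) * w = θ ^ 3 - (8 * j : ℤ) * θ ^ 2 - (5 : ℤ) * θ + (8 * j : ℤ) := by
      push_cast at hwθ ⊢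
      linear_combination hwθ
    have h2 := congrArg (Algebra.trace ℤ (𝓞 K)) e
    rw [map_add, map_sub, map_sub, trace_intCast_mul, trace_intCast_mul, trace_intCast_mul,
      trace_intCast hr, t1, t2, t3] at h2
    nlinarith
  push_cast at hw
  have hs : (w - 2 * j) ^ 2 = 4 * j ^ 2 + 1 := by linear_combination hw
  obtain ⟨e, he⟩ := two_dvd_of_sq_eq (x := 1 + (w - 2 * (j : 𝓞 K))) (a := 1) (c := (j : 𝓞 K) ^ 2)
    (by linear_combination hs)
  have hte : Algebra.trace ℤ (𝓞 K) e = 2 := by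
    have e1 : ((2 : ℤ) : 𝓞 K) * e = ((1 - 2 * j : ℤ) : 𝓞 K) + w := by
      push_cast
      linear_combination -he
    have h2 := congrArg (Algebra.trace ℤ (𝓞 K)) e1
    rw [map_add, trace_intCast_mul, trace_intCast hr, htw] at h2
    linarith
  have he2 : e ^ 2 = e + j ^ 2 := by
    apply mul_left_cancel₀ (by norm_num : (4 : 𝓞 K) ≠ 0)
    linear_combination hs - (2 * e + (w - 2 * j) - 1) * he
  have he2' : (1 - e) ^ 2 = 1 - e + j ^ 2 := by linear_combination he2
  have hte' : Algebra.trace ℤ (𝓞 K) (1 - e) = 2 := by rw [map_sub, t0, hte]; norm_num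
  have hδ : (θ - w) ^ 2 = 2 + 4 * (2 * j * e - j + 2 * j ^ 2) := by
    linear_combination hθ + hw + 4 * j * he
  generalize θ - w = δ at hδ
  obtain ⟨v, hv⟩ : ∃ v, v = 2 * j * e - j + 2 * j ^ 2 := ⟨_, rfl⟩
  rw [← hv] at hδ
  have hτ : (δ + e) ^ 2 - (δ + e) - j ^ 2 = δ ^ 2 + δ * (2 * e - 1) := by linear_combination he2
  have hsq : (δ ^ 2 + δ * (2 * e - 1)) ^ 2
      = 2 + 4 * ((1 + 2 * v) ^ 2 + δ * (1 + 2 * v) * (2 * e - 1) + 2 * j ^ 2 + v * (1 + 4 * j ^ 2)) := by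
    linear_combination (δ ^ 2 + 2 + 4 * v + 2 * δ * (2 * e - 1) + (2 * e - 1) ^ 2) * hδ
      + 4 * (2 + 4 * v) * he2
  generalize (1 + 2 * v) ^ 2 + δ * (1 + 2 * v) * (2 * e - 1) + 2 * j ^ 2 + v * (1 + 4 * j ^ 2) = r
    at hsq
  refine ⟨δ + e, δ ^ 2 + δ * (2 * e - 1), 1, -1, -j ^ 2, ⟨?_, ⟨1 + 2 * r, ?_⟩, ⟨r, ?_⟩, ?_, ?_⟩, ?_⟩
  · push_cast
    linear_combination -hτ
  · linear_combination hsq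
  · linear_combination hsq
  · rintro ⟨z, hz⟩
    refine not_two_dvd_sq_of_trace hr he2 hte ⟨z - δ * e - 1 - 2 * v, ?_⟩
    linear_combination hz - hδ
  · rintro ⟨z, hz⟩
    refine not_two_dvd_sq_of_trace hr he2' hte' ⟨z - δ * e - 1 - 2 * v - δ - 2 * e, ?_⟩
    linear_combination hz - hδ
  · rintro ⟨k, rfl⟩
    push_cast at hτ
    have hβ : (δ + e) ^ 2 = (δ ^ 2 + δ * (2 * e - 1)) + (δ + e) + (2 * k + 1) ^ 2 := by
      linear_combination hτ
    refine ⟨1 + 2 * r + (δ ^ 2 + δ * (2 * e - 1)) * ((δ + e) + (2 * k + 1) ^ 2)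
      + (δ + e) * (2 * k + 1) ^ 2 + (8 * k ^ 4 + 16 * k ^ 3 + 12 * k ^ 2 + 4 * k), ?_⟩
    linear_combination ((δ + e) ^ 2 + (δ ^ 2 + δ * (2 * e - 1)) + (δ + e) + (2 * k + 1) ^ 2) * hβ
      + hsq

end Cases

/-! ### Odd `m`: every index is even. -/

section OddParameter

variable {K : Type*} [Field K] [NumberField K] {θ : 𝓞 K} {m : ℤ}

/-- An integral element completing `1, θ, θ²` to a basis at `2` when `m` is odd. -/
theorem exists_half_cubic (h : θ ^ 4 = m * θ ^ 3 + 6 * θ ^ 2 - m * θ - 1) :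
    ∃ γ : 𝓞 K, θ ^ 3 = 2 * γ + (m + 1) * θ ^ 2 - (m - 5) * θ - 1 ∧
      γ ^ 2 = -(m + 2) * γ - 2 * θ + 2 - m + (θ ^ 3 - m * θ ^ 2 - 5 * θ + m) := by
  obtain ⟨u, hu⟩ : ∃ u, u = θ ^ 3 - m * θ ^ 2 - 5 * θ + m := ⟨_, rfl⟩
  have huθ : θ ^ 2 = u * θ + 1 := by rw [hu]; linear_combination -h
  have huu : u ^ 2 = m * u + 4 := by
    rw [hu]
    linear_combination (θ ^ 2 - m * θ - 4) * h
  -- `γ = (m - u)(θ - 1)/2`.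
  obtain ⟨γ, hγ⟩ := two_dvd_of_sq_eq (x := ((m : 𝓞 K) - u) * (θ - 1)) (a := -((m : 𝓞 K) - u))
    (c := -((m : 𝓞 K) - u) * θ)
    (by linear_combination (m - u) ^ 2 * huθ + (u * θ - m * θ) * huu)
  have huγ : u * γ = -2 * (θ - 1) := by
    apply mul_left_cancel₀ (two_ne_zero (α := 𝓞 K))
    linear_combination -u * hγ - (θ - 1) * huu
  have hγ2 : γ ^ 2 = -(m - u) * γ - (m - u) * θ := by
    apply mul_left_cancel₀ (by norm_num : (4 : 𝓞 K) ≠ 0)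
    linear_combination (-(m - u) * (θ - 1) - 2 * γ - 2 * (m - u)) * hγ
      + (m - u) ^ 2 * huθ + (u * θ - m * θ) * huu
  refine ⟨γ, ?_, ?_⟩
  · linear_combination hγ - huθ - hu
  · rw [← hu]
    linear_combination hγ2 + huγ - hγ

variable (b : Module.Basis (Fin 4) ℤ (𝓞 K))

include b in
/-- The quotient ring modulo `2` satisfies `x⁴ = x` when `m` is odd. -/
theorem two_dvd_pow_four_sub (hθ : IsPrimitiveInt θ) (hm : Odd m)
    (h : θ ^ 4 = m * θ ^ 3 + 6 * θ ^ 2 - m * θ - 1) (x : 𝓞 K) : 2 ∣ x ^ 4 - x := by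
  obtain ⟨γ, hγ3, hγ2⟩ := exists_half_cubic h
  let v : Fin 4 → 𝓞 K := ![1, θ, θ ^ 2, γ]
  have hdet : ¬ 2 ∣ b.det v := by
    rintro ⟨k, hk⟩
    -- Replacing `γ` by `θ³` multiplies the determinant by 2, which uses up the factor 4 of the
    -- discriminant `4(m² + 16)³`; so `1, θ, θ², γ` has odd determinant.
    let P : Matrix (Fin 4) (Fin 4) ℤ :=
      !![1, 0, 0, -1; 0, 1, 0, -(m - 5); 0, 0, 1, m + 1; 0, 0, 0, 2]
    have hP : P.det = 2 := by
      simp [P, Matrix.det_succ_row_zero, Fin.sum_univ_succ, Fin.succAbove]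
    have hv : powers θ = Matrix.vecMul v (P.map (algebraMap ℤ (𝓞 K))) := by
      ext i
      fin_cases i
      · simp [powers, v, P, Matrix.vecMul, dotProduct, Fin.sum_univ_four]
      · simp [powers, v, P, Matrix.vecMul, dotProduct, Fin.sum_univ_four]
      · simp [powers, v, P, Matrix.vecMul, dotProduct, Fin.sum_univ_four]
      · have e : powers θ 3 = θ ^ 3 := rfl
        have e' : Matrix.vecMul v (P.map (algebraMap ℤ (𝓞 K))) 3
            = -1 + θ * (5 - m) + θ ^ 2 * (m + 1) + γ * 2 := by
          simp [v, P, Matrix.vecMul, dotProduct, Fin.sum_univ_four]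
        change ((powers θ 3 : 𝓞 K) : K)
          = ((Matrix.vecMul v (P.map (algebraMap ℤ (𝓞 K))) 3 : 𝓞 K) : K)
        rw [e, e', hγ3]
        congr 1
        ring
    have hd := Algebra.discr_of_matrix_vecMul v P
    rw [← hv, discr_powers (finrank_eq_four_of_basis b) hθ h, discr_eq_det_sq_mul b v, hk, hP] at hd
    have h2 : Odd ((m ^ 2 + 16) ^ 3) := ((hm.pow).add_even (by decide)).pow
    obtain ⟨r, hr⟩ := h2
    rw [hr] at hd
    have h3 : 2 * r + 1 = 4 * (k ^ 2 * Algebra.discr ℤ b) := by linarith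
    omega
  -- Fourth powers are additive mod 2, so `x⁴ ≡ x` need only be checked on `1, θ, θ², γ`.
  have hadd : ∀ x y : 𝓞 K, 2 ∣ x ^ 4 - x → 2 ∣ y ^ 4 - y → 2 ∣ (x + y) ^ 4 - (x + y) := by
    rintro x y ⟨s, hs⟩ ⟨t, ht⟩
    exact ⟨s + t + 2 * x ^ 3 * y + 3 * x ^ 2 * y ^ 2 + 2 * x * y ^ 3, by
      linear_combination hs + ht⟩
  have hsmul : ∀ (k : ℤ) (x : 𝓞 K), 2 ∣ x ^ 4 - x → 2 ∣ (k * x) ^ 4 - k * x := by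
    rintro k x ⟨s, hs⟩
    rcases Int.even_or_odd' k with ⟨l, rfl | rfl⟩
    · push_cast
      exact ⟨8 * l ^ 4 * x ^ 4 - l * x, by ring⟩
    · push_cast
      exact ⟨s * (2 * l + 1) + x ^ 4 * (8 * l ^ 4 + 16 * l ^ 3 + 12 * l ^ 2 + 3 * l), by
        linear_combination (2 * (l : 𝓞 K) + 1) * hs⟩
  obtain ⟨l, hl⟩ := hm
  have hl' : (m : 𝓞 K) = 2 * l + 1 := by rw [hl]; push_cast; ring
  have h1 : (2 : 𝓞 K) ∣ 1 ^ 4 - 1 := by simp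
  have hθ1 : 2 ∣ θ ^ 4 - θ := ⟨m * γ + (2 * l ^ 2 + 3 * l + 4) * θ ^ 2
    - (2 * l ^ 2 - 2 * l - 1) * θ - (l + 1), by
      linear_combination h + (m : 𝓞 K) * hγ3 + ((θ ^ 2 - θ) * (m + 2 * l + 1) + θ ^ 2 + 4 * θ - 1) * hl'⟩
  have hθ2 : 2 ∣ (θ ^ 2) ^ 4 - θ ^ 2 := by
    have e : (θ ^ 2) ^ 4 - θ ^ 2 = (θ ^ 4 - θ) * (θ ^ 4 + θ) := by ring
    rw [e]
    exact hθ1.mul_right _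
  have hγ1 : 2 ∣ γ ^ 4 - γ := by
    obtain ⟨u, hu⟩ : ∃ u, u = θ ^ 3 - m * θ ^ 2 - 5 * θ + m := ⟨_, rfl⟩
    have huu : u ^ 2 = m * u + 4 := by
      rw [hu]
      linear_combination (θ ^ 2 - m * θ - 4) * h
    rw [← hu] at hγ2
    obtain ⟨s, hs⟩ : ∃ s, γ ^ 2 = γ + 1 + u + 2 * s :=
      ⟨-(l + 2) * γ - θ - l, by linear_combination hγ2 - (γ + 1) * hl'⟩
    refine ⟨s + 1 + u + γ + γ * u + u + l * u + 2 + 2 * s ^ 2 + 2 * s * (γ + 1 + u), ?_⟩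
    linear_combination (γ ^ 2 + γ + 2 + u + 2 * s) * hs + huu + u * hl'
  obtain ⟨c, hc⟩ := det_smul_mem_span b v x
  have hsum : 2 ∣ (∑ i, c i • v i) ^ 4 - ∑ i, c i • v i := by
    simp only [Fin.sum_univ_four, zsmul_eq_mul]
    exact hadd _ _ (hadd _ _ (hadd _ _ (hsmul _ _ h1) (hsmul _ _ hθ1)) (hsmul _ _ hθ2))
      (hsmul _ _ hγ1)
  rw [← hc, zsmul_eq_mul] at hsum
  obtain ⟨k, hk⟩ := (Int.not_even_iff_odd.1 (fun h => hdet h.two_dvd) : Odd (b.det v))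
  have hx : x = (b.det v) * x + ((-2 * k : ℤ) : 𝓞 K) * x := by
    rw [hk]
    push_cast
    ring
  rw [hx]
  refine hadd _ _ hsum ⟨8 * k ^ 4 * x ^ 4 + k * x, ?_⟩
  push_cast
  ring

theorem two_dvd_det_powers {α : 𝓞 K} (hF : ∀ x : 𝓞 K, 2 ∣ x ^ 4 - x)
    (hroot : ∀ z : ℤ_[2], aeval z (intCharpoly α) ≠ 0) : 2 ∣ b.det (powers α) := by
  by_contra hdet
  have hdeg : (intCharpoly α).natDegree = 4 := by
    rw [natDegree_intCharpoly, finrank_eq_four_of_basis b]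
  obtain ⟨a₃, a₂, a₁, a₀, hG⟩ := exists_quartic_coeffs (intCharpoly_monic α) hdeg
  have h0 := aeval_intCharpoly α
  rw [hG] at h0
  simp at h0
  -- The coefficients of `F_α - (X⁴ - X)`; an odd determinant makes them all even.
  have hsum : ((2 : ℤ) : 𝓞 K) ∣ ∑ i, (![a₀, a₁ + 1, a₂, a₃] : Fin 4 → ℤ) i • powers α i := by
    rw [sum_smul_powers]
    obtain ⟨z, hz⟩ := hF α
    refine ⟨-z, ?_⟩
    simp
    linear_combination h0 - hz
  have d0 := dvd_coeff_of_dvd_sum b Int.prime_two hdet hsum 0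
  have d1 := dvd_coeff_of_dvd_sum b Int.prime_two hdet hsum 1
  simp at d0 d1
  obtain ⟨z, hz⟩ := exists_padicInt_root_of_not_dvd_derivative (p := 2) (F := intCharpoly α) (a := 0)
    (by rw [hG]; simpa using d0) (by rw [hG]; simp; omega)
  exact hroot z hz

end OddParameter

/-! ### An element whose characteristic values are all divisible by 4. -/

section LowerBound

variable {K : Type*} [Field K] [NumberField K] {θ : 𝓞 K}

/-- If `θ` is quadratic over the quadratic order generated by `x`, and `x` has distinct residues at
the two primes above `2`, then `x + 4θ` is primitive with all characteristic values divisible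
by `4`. -/
theorem exists_four_dvd_valueGcd (hr : Module.finrank ℚ K = 4) (hθ : IsPrimitiveInt θ) {x : 𝓞 K}
    {r s t v : ℤ} (ht : Odd t) (hx : x ^ 2 = t * x + ((4 * v : ℤ) : 𝓞 K))
    (hθx : θ ^ 2 = (r + s * x) * θ + 1) :
    ∃ α : 𝓞 K, IsPrimitiveInt α ∧ 4 ∣ valueGcd α := by
  push_cast at hx
  obtain ⟨α, hα⟩ : ∃ α, α = x + 4 * θ := ⟨_, rfl⟩
  obtain ⟨c, hc⟩ : ∃ c : ℤ, c = t + 4 * r + 4 * s * t := ⟨_, rfl⟩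
  obtain ⟨d, hd⟩ : ∃ d : ℤ, d = 2 + 4 * s := ⟨_, rfl⟩
  obtain ⟨a, ha⟩ : ∃ a : ℤ, a = (1 + 4 * s) * (4 * v) - 16 := ⟨_, rfl⟩
  -- Eliminating `θ` gives `A + xB = 0` with `A`, `B` polynomials in `α`. If `B ≠ 0`, then `x`,
  -- hence `θ`, lies in `ℚ(α)`.
  have hrel : (α ^ 2 - 4 * r * α + a) + x * (c - d * α) = 0 := by
    rw [hα, hc, hd, ha]
    push_cast
    linear_combination 16 * hθx + (-1 - 4 * s : 𝓞 K) * hx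
  have hd0 : d ≠ 0 := by omega
  have hB : (c : 𝓞 K) - d * α ≠ 0 := by
    intro h0
    have hli := linearIndependent_powers_of_isPrimitiveInt hr hθ
    have h1 := Fintype.linearIndependent_iff.1 hli ![-d, -(r * d + s * c), (1 + 4 * s) * d, 0] (by
      rw [sum_smul_powers]
      simp
      rw [hα] at h0
      linear_combination (d : 𝓞 K) * hθx - s * θ * h0) 0
    simp at h1
    exact hd0 h1
  have hprim : IsPrimitiveInt α := by
    have hαL : (α : K) ∈ ℚ⟮(α : K)⟯ := IntermediateField.mem_adjoin_simple_self ℚ _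
    have hint : ∀ n : ℤ, (n : K) ∈ ℚ⟮(α : K)⟯ := fun n => intCast_mem _ n
    have hBK : (c : K) - d * (α : K) ≠ 0 := by
      intro h0
      apply hB
      apply NumberField.RingOfIntegers.coe_injective
      simpa using h0
    have hrelK : ((α : K) ^ 2 - 4 * r * α + a) + x * (c - d * (α : K)) = 0 := by
      have := congrArg (algebraMap (𝓞 K) K) hrel
      simpa [map_ofNat] using this
    have hxL : (x : K) ∈ ℚ⟮(α : K)⟯ := by
      have : (x : K) = -((α : K) ^ 2 - ((4 * r : ℤ) : K) * α + a) / (c - d * (α : K)) := by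
        rw [eq_div_iff hBK]
        push_cast
        linear_combination hrelK
      rw [this]
      exact div_mem (neg_mem (add_mem (sub_mem (pow_mem hαL 2) (mul_mem (hint _) hαL)) (hint _)))
        (sub_mem (hint _) (mul_mem (hint _) hαL))
    have hθL : (θ : K) ∈ ℚ⟮(α : K)⟯ := by
      have : (θ : K) = ((α : K) - x) / ((4 : ℤ) : K) := by
        have := congrArg (algebraMap (𝓞 K) K) hα
        simp only [map_add, map_mul, map_ofNat] at this
        rw [eq_div_iff (by norm_num)]
        push_cast
        linear_combination -this
      rw [this]
      exact div_mem (sub_mem hαL hxL) (hint _)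
    have hθ' : ℚ⟮(θ : K)⟯ = ⊤ := hθ
    have hle : ℚ⟮(θ : K)⟯ ≤ ℚ⟮(α : K)⟯ := by
      rw [IntermediateField.adjoin_simple_le_iff]
      exact hθL
    rw [IsPrimitiveInt, eq_top_iff, ← hθ']
    exact hle
  refine ⟨α, hprim, dvd_valueGcd fun n => ?_⟩
  -- The norm of `A + xB` from `k`, namely `A² + tAB - 4vB²`; mod 4 it is `(X(X - t))²`.
  have hG : intCharpoly α = X ^ 4 + C (-8 * r - t * d) * X ^ 3
      + C (16 * r ^ 2 + 2 * a + t * (c + 4 * r * d) - 4 * v * d ^ 2) * X ^ 2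
      + C (-8 * r * a - t * (4 * r * c + d * a) + 8 * v * c * d) * X
      + C (a ^ 2 + t * c * a - 4 * v * c ^ 2) := by
    refine intCharpoly_eq_of_aeval_eq_zero hprim (by monicity!) ?_ ?_
    · rw [hr]
      compute_degree!
    · simp [map_ofNat]
      linear_combination ((α ^ 2 - 4 * r * α + a) - x * (c - d * α) + t * (c - d * α)) * hrel
        + (c - d * α) ^ 2 * hx
  obtain ⟨q, hq⟩ : 2 ∣ n * (n - t) := by
    obtain ⟨k, rfl⟩ := ht
    rcases Int.even_or_odd' n with ⟨l, rfl | rfl⟩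
    · exact ⟨l * (2 * l - (2 * k + 1)), by ring⟩
    · exact ⟨(2 * l + 1) * (l - k), by ring⟩
  rw [hG]
  simp only [eval_add, eval_mul, eval_pow, eval_X, eval_C]
  have hA : n ^ 2 - 4 * r * n + a = n ^ 2 + 4 * (-r * n + (1 + 4 * s) * v - 4) := by rw [ha]; ring
  have hB' : c - d * n = t - 2 * n + 4 * (r + s * t - s * n) := by rw [hc, hd]; ring
  generalize -r * n + (1 + 4 * s) * v - 4 = A' at hA
  generalize r + s * t - s * n = B' at hB'
  refine ⟨2 * n ^ 2 * A' + 4 * A' ^ 2 + t * (n ^ 2 * B' + A' * (t - 2 * n) + 4 * A' * B')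
    - v * (c - d * n) ^ 2 + q ^ 2, ?_⟩
  push_cast
  linear_combination (n ^ 2 - 4 * r * n + a + n ^ 2 + 4 * A' + t * (c - d * n)) * hA
    + t * (n ^ 2 + 4 * A') * hB' + (n * (n - t) + 2 * q) * hq

end LowerBound

/-! ### Assembly of the index and the lcm. -/

section Main

variable {K : Type*} [Field K] [NumberField K]

theorem finrank_eq_four {m : ℤ} (hm : 0 < m) (hm3 : m ≠ 3) {θ : K}
    (hroot : aeval θ (simplestQuartic m) = 0) (hgen : IntermediateField.adjoin ℚ {θ} = ⊤) :
    Module.finrank ℚ K = 4 := by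
  rw [← (Field.primitive_element_iff_minpoly_natDegree_eq ℚ θ).1 hgen]
  have hirr : Irreducible ((simplestQuartic m).map (algebraMap ℤ ℚ)) :=
    ((simplestQuartic_monic m).irreducible_iff_irreducible_map_fraction_map).1
      (simplestQuartic_irreducible hm hm3)
  rw [← minpoly.eq_of_irreducible_of_monic hirr
    (by rw [Polynomial.aeval_map_algebraMap, hroot]) ((simplestQuartic_monic m).map _),
    (simplestQuartic_monic m).natDegree_map, natDegree_simplestQuartic]

theorem intCharpoly_no_padicInt_root {m : ℤ} {θ : K} (hroot : aeval θ (simplestQuartic m) = 0)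
    {α : 𝓞 K} (hα : IsPrimitiveInt α) :
    (∀ z : ℤ_[2], aeval z (intCharpoly α) ≠ 0) ∧ ∀ z : ℤ_[3], aeval z (intCharpoly α) ≠ 0 := by
  constructor
  · intro z hz
    obtain ⟨y, hy⟩ := exists_padicInt_root hα hz (simplestQuartic_monic m) hroot
    exact aeval_simplestQuartic_two_ne_zero m y hy
  · intro z hz
    obtain ⟨y, hy⟩ := exists_padicInt_root hα hz (simplestQuartic_monic m) hroot
    exact aeval_simplestQuartic_three_ne_zero m y hy

theorem valueGcd_dvd_four (hr : Module.finrank ℚ K = 4) {m : ℤ} {θ : K}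
    (hroot : aeval θ (simplestQuartic m) = 0) {α : 𝓞 K} (hα : IsPrimitiveInt α) :
    valueGcd α ∣ 4 := by
  have hmon := intCharpoly_monic α
  have hdeg : (intCharpoly α).natDegree = 4 := by rw [natDegree_intCharpoly, hr]
  have h24 : valueGcd α ∣ 24 := by
    have := dvd_factorial_of_dvd_eval hmon hdeg (valueGcd_dvd α)
    exact_mod_cast this
  obtain ⟨h2, h3⟩ := intCharpoly_no_padicInt_root hroot hα
  have h8 : ¬ 8 ∣ valueGcd α := fun h => by
    obtain ⟨z, hz⟩ := exists_padicInt_root_of_eight_dvd hmon hdeg fun x =>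
      (by exact_mod_cast h : (8 : ℤ) ∣ valueGcd α).trans (valueGcd_dvd α x)
    exact h2 z hz
  have h3' : ¬ 3 ∣ valueGcd α := fun h => by
    obtain ⟨z, hz⟩ := exists_padicInt_root_of_three_dvd hmon hdeg fun x =>
      (by exact_mod_cast h : (3 : ℤ) ∣ valueGcd α).trans (valueGcd_dvd α x)
    exact h3 z hz
  generalize valueGcd α = n at *
  have hle := Nat.le_of_dvd (by norm_num) h24
  interval_cases n <;> omega

theorem eq_one_of_forall_prime_not_dvd {n : ℕ} (h : ∀ p : ℕ, p.Prime → ¬ p ∣ n) : n = 1 := by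
  by_contra hn
  obtain ⟨p, hp, hpn⟩ := Nat.exists_prime_and_dvd hn
  exact h p hp hpn

variable {θ : 𝓞 K} {m : ℤ} (b : Module.Basis (Fin 4) ℤ (𝓞 K))

include b

theorem fieldIndex_dvd_natAbs_det {α : 𝓞 K} (hα : IsPrimitiveInt α) :
    (fieldIndex K : ℤ) ∣ b.det (powers α) := by
  rw [← Int.dvd_natAbs, Int.natCast_dvd_natCast, ← elementIndex_eq_natAbs_det b
    (det_ne_zero_of_linearIndependent b
      (linearIndependent_powers_of_isPrimitiveInt (finrank_eq_four_of_basis b) hα))]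
  exact Nat.setGcd_dvd_of_mem ⟨α, hα, rfl⟩

theorem dvd_fieldIndex {n : ℕ}
    (h : ∀ α : 𝓞 K, IsPrimitiveInt α → (n : ℤ) ∣ b.det (powers α)) : n ∣ fieldIndex K := by
  rw [fieldIndex, Nat.dvd_setGcd_iff]
  rintro _ ⟨α, hα, rfl⟩
  rw [elementIndex_eq_natAbs_det b (det_ne_zero_of_linearIndependent b
      (linearIndependent_powers_of_isPrimitiveInt (finrank_eq_four_of_basis b) hα)),
    ← Int.natCast_dvd_natCast, Int.dvd_natAbs]
  exact h α hα

theorem not_dvd_fieldIndex_of_odd (hθ : IsPrimitiveInt θ)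
    (h : θ ^ 4 = m * θ ^ 3 + 6 * θ ^ 2 - m * θ - 1)
    (hsq : ∀ d : ℤ, Odd d → d ^ 2 ∣ m ^ 2 + 16 → IsUnit d)
    {p : ℕ} (hp : p.Prime) (hp2 : p ≠ 2) : ¬ p ∣ fieldIndex K := fun hdvd =>
  not_dvd_det_powers_of_odd b hθ h hsq hp hp2
    ((Int.natCast_dvd_natCast.2 hdvd).trans (fieldIndex_dvd_natAbs_det b hθ))

theorem fieldIndex_eq_two (hθ : IsPrimitiveInt θ) (hm : Odd m)
    (h : θ ^ 4 = m * θ ^ 3 + 6 * θ ^ 2 - m * θ - 1)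
    (hsq : ∀ d : ℤ, Odd d → d ^ 2 ∣ m ^ 2 + 16 → IsUnit d) : fieldIndex K = 2 := by
  have hroot : aeval (θ : K) (simplestQuartic m) = 0 := by
    have h0 : aeval θ (simplestQuartic m) = 0 := by
      rw [aeval_simplestQuartic]
      linear_combination h
    have := Polynomial.aeval_algebraMap_apply K θ (simplestQuartic m)
    rwa [h0, map_zero] at this
  obtain ⟨k, hk⟩ : 2 ∣ fieldIndex K := dvd_fieldIndex b fun α hα =>
    two_dvd_det_powers b (two_dvd_pow_four_sub b hθ hm h)
      (intCharpoly_no_padicInt_root hroot hα).1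
  have hk1 : k = 1 := by
    refine eq_one_of_forall_prime_not_dvd fun p hp hpk => ?_
    by_cases hp2 : p = 2
    · subst hp2
      obtain ⟨l, rfl⟩ := hpk
      refine not_four_dvd_det_powers b hθ h hm (dvd_trans ?_ (fieldIndex_dvd_natAbs_det b hθ))
      rw [hk]
      exact ⟨l, by push_cast; ring⟩
    · exact not_dvd_fieldIndex_of_odd b hθ h hsq hp hp2 (hk ▸ hpk.mul_left 2)
  rw [hk, hk1]

theorem exists_isLocalGenerator_of_even (hθ : IsPrimitiveInt θ) (hm : Even m)
    (h : θ ^ 4 = m * θ ^ 3 + 6 * θ ^ 2 - m * θ - 1) :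
    ∃ (β τ ξ : 𝓞 K) (p q : ℤ), IsLocalGenerator β τ ξ p q ∧
      (¬ 16 ∣ m → 2 ∣ β ^ 4 ∨ 2 ∣ β ^ 4 - (β ^ 2 + 1)) := by
  obtain ⟨n, rfl⟩ := hm.two_dvd
  rcases Int.even_or_odd n with hn | hn
  · obtain ⟨j, rfl⟩ := hn.two_dvd
    rcases Int.even_or_odd j with hj | hj
    · obtain ⟨i, rfl⟩ := hj.two_dvd
      have e : 2 * (2 * (2 * i)) = 2 * (4 * i) := by ring
      rw [e] at h ⊢
      obtain ⟨β, τ, ξ, p, q, hβ, hodd⟩ :=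
        exists_isLocalGenerator_of_eight_mul (finrank_eq_four_of_basis b) hθ h
      refine ⟨β, τ, ξ, p, q, hβ, fun h16 => Or.inr (hodd ?_)⟩
      rw [← Int.not_even_iff_odd]
      rintro ⟨l, rfl⟩
      exact h16 ⟨l, by ring⟩
    · obtain ⟨β, τ, ξ, p, q, hβ, h4⟩ := exists_isLocalGenerator_of_four_mul_odd hj h
      exact ⟨β, τ, ξ, p, q, hβ, fun _ => Or.inl h4⟩
  · obtain ⟨β, τ, ξ, p, q, hβ, h4⟩ := exists_isLocalGenerator_of_two_mul_odd hn h
    exact ⟨β, τ, ξ, p, q, hβ, fun _ => Or.inr h4⟩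

theorem fieldIndex_eq_one (hθ : IsPrimitiveInt θ) (hm : Even m)
    (h : θ ^ 4 = m * θ ^ 3 + 6 * θ ^ 2 - m * θ - 1)
    (hsq : ∀ d : ℤ, Odd d → d ^ 2 ∣ m ^ 2 + 16 → IsUnit d) : fieldIndex K = 1 := by
  refine eq_one_of_forall_prime_not_dvd fun p hp hpk => ?_
  by_cases hp2 : p = 2
  · subst hp2
    obtain ⟨β, τ, ξ, p, q, hβ, -⟩ := exists_isLocalGenerator_of_even b hθ hm h
    have hdet := hβ.not_two_dvd_det b
    have hprim : IsPrimitiveInt β := isPrimitiveInt_of_linearIndependent b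
      (linearIndependent_of_det_ne_zero b fun h0 => hdet (h0 ▸ dvd_zero 2))
    exact hdet ((Int.natCast_dvd_natCast.2 hpk).trans (fieldIndex_dvd_natAbs_det b hprim))
  · exact not_dvd_fieldIndex_of_odd b hθ h hsq hp hp2 hpk

theorem fieldValueLcm_eq_one (hθ : IsPrimitiveInt θ) (hm : Even m) (h16 : ¬ 16 ∣ m)
    (hdvd : ∀ α : 𝓞 K, IsPrimitiveInt α → valueGcd α ∣ 4)
    (h : θ ^ 4 = m * θ ^ 3 + 6 * θ ^ 2 - m * θ - 1) : fieldValueLcm K = 1 := by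
  obtain ⟨β, τ, ξ, p, q, hβ, h4⟩ := exists_isLocalGenerator_of_even b hθ hm h
  refine setLcm_eq one_pos ?_ fun d _ => one_dvd d
  rintro _ ⟨α, hα, rfl⟩
  have h2 := not_two_dvd_valueGcd_of_local b hβ.eq hβ.two_dvd (hβ.not_two_dvd_det b) (h4 h16) α
  have h5 := hdvd α hα
  generalize valueGcd α = n at *
  have hle := Nat.le_of_dvd (by norm_num) h5
  interval_cases n <;> omega

theorem fieldValueLcm_eq_four (hθ : IsPrimitiveInt θ) (hm : Odd m ∨ 16 ∣ m)
    (hdvd : ∀ α : 𝓞 K, IsPrimitiveInt α → valueGcd α ∣ 4)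
    (h : θ ^ 4 = m * θ ^ 3 + 6 * θ ^ 2 - m * θ - 1) : fieldValueLcm K = 4 := by
  have hr := finrank_eq_four_of_basis b
  obtain ⟨α, hα, h4⟩ : ∃ α : 𝓞 K, IsPrimitiveInt α ∧ 4 ∣ valueGcd α := by
    rcases hm with hm | ⟨k, rfl⟩
    -- `x = u`, with `u² = mu + 4` and `θ² = uθ + 1`.
    · refine exists_four_dvd_valueGcd hr hθ (x := θ ^ 3 - m * θ ^ 2 - 5 * θ + m) (r := 0) (s := 1)
        (v := 1) hm ?_ ?_
      · push_cast
        linear_combination (θ ^ 2 - m * θ - 4) * h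
      · push_cast
        linear_combination -h
    · have e : 16 * k = 2 * (8 * k) := by ring
      rw [e] at h
      obtain ⟨w, hw, hθw, -⟩ := exists_half h
      push_cast at hw
      obtain ⟨x, hx⟩ := two_dvd_of_sq_eq (x := 1 + (w - 4 * (k : 𝓞 K))) (a := 1)
        (c := 4 * (k : 𝓞 K) ^ 2) (by linear_combination hw)
      -- From `x = (1 + w - 4k)/2` one gets `2w = 4x + 8k - 2`, which gives `r` and `s`.
      refine exists_four_dvd_valueGcd hr hθ (x := x) (r := 8 * k - 2) (s := 4) (t := 1)
        (v := k ^ 2) (by decide) ?_ ?_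
      · push_cast
        apply mul_left_cancel₀ (by norm_num : (4 : 𝓞 K) ≠ 0)
        linear_combination hw - (2 * x + (w - 4 * k) - 1) * hx
      · push_cast
        linear_combination hθw + 2 * θ * hx
  refine setLcm_eq (by norm_num) ?_ fun d hd => h4.trans (hd _ ⟨α, hα, rfl⟩)
  rintro _ ⟨γ, hγ, rfl⟩
  exact hdvd γ hγ

end Main

end CommonIndex

/-- For every number field `K` generated by a root `θ` of `P_m`. -/
theorem theorem5 (m : ℤ) (hm : 0 < m) (hm3 : m ≠ 3)
    (hsq : ∀ d : ℤ, Odd d → d ^ 2 ∣ m ^ 2 + 16 → IsUnit d)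
    (K : Type*) [Field K] [NumberField K] (θ : K)
    (hroot : Polynomial.aeval θ (CommonIndex.simplestQuartic m) = 0)
    (hgen : IntermediateField.adjoin ℚ {θ} = ⊤) :
    (Odd m → CommonIndex.fieldIndex K = 2) ∧
    (Even m → CommonIndex.fieldIndex K = 1) ∧
    (1 ≤ padicValInt 2 m ∧ padicValInt 2 m ≤ 3 → CommonIndex.fieldValueLcm K = 1) ∧
    (¬ (1 ≤ padicValInt 2 m ∧ padicValInt 2 m ≤ 3) → CommonIndex.fieldValueLcm K = 4) := by
  have hr := CommonIndex.finrank_eq_four hm hm3 hroot hgen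
  let b : Module.Basis (Fin 4) ℤ (𝓞 K) :=
    Module.finBasisOfFinrankEq ℤ (𝓞 K) ((NumberField.RingOfIntegers.rank K).trans hr)
  have hint : IsIntegral ℤ θ :=
    ⟨CommonIndex.simplestQuartic m, CommonIndex.simplestQuartic_monic m, hroot⟩
  obtain ⟨η, hη⟩ : ∃ η : 𝓞 K, (η : K) = θ := ⟨⟨θ, hint⟩, rfl⟩
  have hprim : CommonIndex.IsPrimitiveInt η := by
    rw [CommonIndex.IsPrimitiveInt, hη]
    exact hgen
  have h : η ^ 4 = m * η ^ 3 + 6 * η ^ 2 - m * η - 1 := by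
    apply NumberField.RingOfIntegers.coe_injective
    rw [CommonIndex.aeval_simplestQuartic, ← hη] at hroot
    simp only [map_add, map_sub, map_mul, map_pow, map_intCast, map_ofNat, map_one]
    linear_combination hroot
  have hdvd : ∀ α : 𝓞 K, CommonIndex.IsPrimitiveInt α → CommonIndex.valueGcd α ∣ 4 :=
    fun α hα => CommonIndex.valueGcd_dvd_four hr hroot hα
  have h2 : 1 ≤ padicValInt 2 m ↔ Even m := by
    have := padicValInt_dvd_iff (p := 2) 1 m
    rw [even_iff_two_dvd]
    simpa [hm.ne'] using this.symm
  have h16 : padicValInt 2 m ≤ 3 ↔ ¬ 16 ∣ m := by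
    have := padicValInt_dvd_iff (p := 2) 4 m
    simp only [hm.ne', false_or] at this
    norm_num at this
    omega
  refine ⟨fun hodd => CommonIndex.fieldIndex_eq_two b hprim hodd h hsq,
    fun heven => CommonIndex.fieldIndex_eq_one b hprim heven h hsq,
    fun hv => CommonIndex.fieldValueLcm_eq_one b hprim (h2.1 hv.1) (h16.1 hv.2) hdvd h,
    fun hv => CommonIndex.fieldValueLcm_eq_four b hprim ?_ hdvd h⟩
  rw [h2, h16, not_and_or, not_not, Int.not_even_iff_odd] at hv
  exact hv
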